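/- Let $L$ be a finite geometric lattice with minimal element $0$, rank function $\operatorname{rk}$, rank $n$ and set of atoms $\mathbb{A}(L)$; write $y\prec x$ if $x$ covers $y$. A chain complex $V_n\to\dots\to V_1\to V_0$ of modules over a ring is compatibly $L$-graded if it is equipped with submodules $V_x\subset V_{\operatorname{rk}(x)}$ ($x\in L$) such that $V_i=\bigoplus_{\operatorname{rk}(x)=i}V_x$ for all $i$ and $\partial V_x\subset\bigoplus_{y\prec x}V_y$ for all $x\neq 0$. For $x\in L$ let $V_{\le x}=\bigoplus_{y\le x}V_y$, a complex graded by $L_{\le x}=\{y\in L: y\le x\}$. An $L$-homotopy for $V$ consists of linear maps $d_0:\operatorname{Im}\partial_1\to V_1$ and $d_i:V_i\to V_{i+1}$ ($1\le i\le n$, $V_{n+1}=0$) with $d_{i-1}\partial_i+\partial_{i+1}d_i=\operatorname{id}_{V_i}$ for $1\le i\le n$ and $d_{\operatorname{rk}(x)}(V_x)\subset\bigoplus_{y\succ x}V_y$ for $x\neq 0$. $V$ is $L$-contractible if for every $x\in L$ the complex $V_{\le x}$ admits an $L_{\le x}$-homotopy. A complex is called exact if $\operatorname{Ker}\partial_i=\operatorname{Im}\partial_{i+1}$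 for $i=1,\dots,n$ ($\partial_1$ need not be onto). Let $V$ be a compatibly $L$-graded complex of vector spaces over a field $K$ of characteristic zero. Let $S(V)$ be the quotient of the tensor algebra of $\bigoplus_i V_i$ by the relations $uv=(-1)^{ij}vu$ ($u\in V_i$, $v\in V_j$), with its super-derivation $\tilde\partial$ extending $\partial$. It is graded by degree ($V_i$ in degree $i$) and by $L$: $S(V)_x$ is spanned by the products $r_1\cdots r_m$ with $r_i\in V_{x_i}$ and $x_1\vee\dots\vee x_m=x$. Let $I$ be the span of all products $r_1\cdots r_m$, $r_i\in V_{x_i}$, with $\sum_i\operatorname{rk}(x_i)>\operatorname{rk}(\bigvee_i x_i)$, let $\mathcal{I}(L,V)=I+\tilde\partial I$ (a two-sided differential ideal), and let $\tilde{\mathcal{A}}(V)=S(V)/\mathcal{I}(L,V)$ be the generalized Orlik--Solomon algebra, with the induced differential and degree and with $\tilde{\mathcal{A}}(V)_x$ the image of $S(V)_x$. An atomic datum over a ring $R$ is an $R$-module $U_0$ with submodules $U_a$, $a\in\mathbb{A}(L)$. Its minimal complex $\mathcal{O}(U_0,(U_a))$ is the compatibly $L$-graded complex of $R$-modules whose component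 at $0$ is $U_0$, whose component at an atom $a$ is $U_a$ with the inclusion into $U_0$ as differential, and whose component at $x$ with $\operatorname{rk}(x)>1$ is the kernel of the differential on the direct sum of the components at the $y\prec x$, with the inclusion as differential. **Proposition.** Suppose that $V$ is $L$-contractible. Then $\tilde{\mathcal{A}}(V)$, with the components $\tilde{\mathcal{A}}(V)_x$, is a compatibly $L$-graded complex of $K$-vector spaces (for its grading by degree), and it is $L$-contractible. If in addition the maps $\partial_1|_{V_a}$, $a\in\mathbb{A}(L)$, are all injective, then $\tilde{\mathcal{A}}(V)$ is isomorphic, as an $L$-graded complex of $\operatorname{Sym}(V_0)$-modules, and by an isomorphism which is the canonical map $\operatorname{Sym}V_0\to\tilde{\mathcal{A}}(V)$ in degree $0$, to the minimal complex \[\mathcal{O}\bigl(\operatorname{Sym}V_0,(\langle\partial V_a\rangle)_{a\in\mathbb{A}(L)}\bigr)\] over $\operatorname{Sym}V_0$, where $\langle\partial V_a\rangle$ is the ideal of $\operatorname{Sym}V_0$ generated by $\partial V_a$; and this minimal complex is exact. -/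

import Mathlib

noncomputable section

namespace GenOS

/-! ### Rank and dependency in a finite lattice -/

/-- The rank `rk x` of an element of a finite poset: the length of a longest chain
`x₀ < ⋯ < x_k = x`. In a geometric lattice this is the usual rank function. -/
def rk {L : Type*} [Preorder L] (x : L) : ℕ := (Order.height x).toNat

/-- Saturated chains of length `n` from `w` to `y` (auxiliary). -/
inductive Sat {L : Type*} [Preorder L] : ℕ → L → L → Prop where
  | refl (x : L) : Sat 0 x x
  | step {n : ℕ} {w a y : L} (h : w ⋖ a) (h' : Sat n a y) : Sat (n + 1) w y

theorem Sat.le {L : Type*} [Preorder L] {n : ℕ} {w y : L} (h : Sat n w y) : w ≤ y := by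
  induction h with
  | refl => exact le_rfl
  | step h _ ih => exact h.le.trans ih

theorem Sat.trans {L : Type*} [Preorder L] {n m : ℕ} {w y z : L} (h : Sat n w y)
    (h' : Sat m y z) : Sat (n + m) w z := by
  induction h with
  | refl => simpa using h'
  | step h _ ih => rw [Nat.add_right_comm]; exact Sat.step h (ih h')

theorem Sat.exists {L : Type*} [PartialOrder L] [Finite L] {w y : L} (h : w ≤ y) :
    ∃ n, Sat n w y := by
  induction w using WellFoundedGT.induction with
  | ind w ih =>
    rcases h.eq_or_lt with rfl | hlt
    · exact ⟨0, Sat.refl _⟩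
    · obtain ⟨a, ha, hay⟩ := exists_covBy_le_of_lt hlt
      obtain ⟨n, hn⟩ := ih a ha.lt hay
      exact ⟨n + 1, Sat.step ha hn⟩

theorem Sat.unique {L : Type*} [Lattice L] [IsUpperModularLattice L] [Finite L] {n : ℕ} :
    ∀ {m : ℕ} {w y : L}, Sat n w y → Sat m w y → m = n := by
  induction n with
  | zero =>
    intro m w y h h'
    cases h
    cases h' with
    | refl => rfl
    | step h h' => exact absurd (h.lt.trans_le h'.le) (lt_irrefl _)
  | succ n ih =>
    intro m w y h h'
    cases h with
    | @step _ _ a _ ha hay =>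
      cases h' with
      | refl => exact absurd (ha.lt.trans_le hay.le) (lt_irrefl _)
      | @step m _ b _ hb hby =>
        by_cases hab : a = b
        · subst hab
          rw [ih hay hby]
        · have hinf : a ⊓ b = w := by
            rcases ha.eq_or_eq (le_inf ha.le hb.le) inf_le_left with h | h
            · exact h
            · rcases hb.eq_or_eq (le_inf ha.le hb.le) inf_le_right with h' | h'
              · exact h'
              · exact absurd (h.symm.trans h') hab
          have h1 : b ⋖ a ⊔ b := by
            apply IsUpperModularLattice.covBy_sup_of_inf_covBy
            rw [hinf]; exact ha
          have h2 : a ⋖ a ⊔ b := by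
            rw [sup_comm]
            apply IsUpperModularLattice.covBy_sup_of_inf_covBy
            rw [inf_comm, hinf]; exact hb
          obtain ⟨k, hk⟩ := Sat.exists (sup_le hay.le hby.le)
          have e1 : k + 1 = n := ih hay (Sat.step h2 hk)
          have e2 : Sat n b y := e1 ▸ Sat.step h1 hk
          rw [ih e2 hby]

theorem Sat.height_eq {L : Type*} [Lattice L] [OrderBot L] [IsUpperModularLattice L] [Finite L]
    (x : L) : ∀ {n : ℕ}, Sat n ⊥ x → Order.height x = n := by
  induction x using WellFoundedLT.induction with
  | ind x ih =>
    intro n hn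
    apply le_antisymm
    · rw [Order.height_le_coe_iff]
      intro z hz
      obtain ⟨k, hk⟩ := Sat.exists (bot_le (a := z))
      obtain ⟨j, hj⟩ := Sat.exists hz.le
      rw [ih z hz hk]
      have := Sat.unique hn (hk.trans hj)
      have hj0 : j ≠ 0 := by
        rintro rfl
        cases hj
        exact lt_irrefl _ hz
      exact_mod_cast (by omega : k < n)
    · clear ih
      have key : ∀ {m : ℕ} {w y : L}, Sat m w y → Order.height w + m ≤ Order.height y := by
        intro m w y h
        induction h with
        | refl => simp
        | step h _ ih =>
          refine le_trans ?_ ih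
          push_cast
          rw [add_comm _ (1 : ℕ∞), ← add_assoc]
          exact add_le_add_left (Order.height_add_one_le h.lt) _
      simpa using key hn

theorem rk_eq {L : Type*} [Lattice L] [OrderBot L] [IsUpperModularLattice L] [Finite L]
    {x : L} {n : ℕ} (h : Sat n ⊥ x) : rk x = n := by
  rw [rk, Sat.height_eq x h]; rfl

theorem rk_add {L : Type*} [Lattice L] [OrderBot L] [IsUpperModularLattice L] [Finite L]
    {x y : L} {n : ℕ} (h : Sat n x y) : rk y = rk x + n := by
  obtain ⟨k, hk⟩ := Sat.exists (bot_le (a := x))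
  rw [rk_eq hk, rk_eq (hk.trans h)]

theorem rk_bot {L : Type*} [Preorder L] [OrderBot L] : rk (⊥ : L) = 0 := by
  simp [rk]

theorem rk_covBy {L : Type*} [Lattice L] [OrderBot L] [IsUpperModularLattice L] [Finite L]
    {x y : L} (h : x ⋖ y) : rk y = rk x + 1 :=
  rk_add (Sat.step h (Sat.refl y))

theorem rk_sup_le {L : Type*} [Lattice L] [OrderBot L] [IsUpperModularLattice L] [Finite L]
    (a b : L) : rk (a ⊔ b) ≤ rk a + rk b := by
  have key : ∀ {m : ℕ} {w y : L}, Sat m w y → rk (a ⊔ y) ≤ rk (a ⊔ w) + m := by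
    intro m w y h
    induction h with
    | refl => simp
    | @step n w c y h _ ih =>
      have h1 : rk (a ⊔ c) ≤ rk (a ⊔ w) + 1 := by
        rcases h.wcovBy.eq_or_eq (c := c ⊓ (a ⊔ w)) (le_inf h.le le_sup_right) inf_le_left
          with h' | h'
        · have : a ⊔ w ⋖ c ⊔ (a ⊔ w) :=
            IsUpperModularLattice.covBy_sup_of_inf_covBy (h'.symm ▸ h)
          have e : c ⊔ (a ⊔ w) = a ⊔ c := by
            rw [sup_left_comm, sup_eq_left.2 h.le]
          rw [e] at this
          exact (rk_covBy this).le
        · have : a ⊔ c ≤ a ⊔ w := sup_le le_sup_left (inf_eq_left.1 h')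
          have e : a ⊔ c = a ⊔ w := le_antisymm this (sup_le_sup_left h.le a)
          rw [e]; omega
      omega
  obtain ⟨n, hn⟩ := Sat.exists (bot_le (a := b))
  have := key hn
  rw [sup_bot_eq] at this
  rwa [rk_eq hn]

/-- The join of a finite family of elements. -/
def join {L : Type*} [Lattice L] [OrderBot L] (l : List L) : L := l.foldr (· ⊔ ·) ⊥

/-- A finite family `x₁, …, x_m` is dependent if `rk (x₁ ∨ ⋯ ∨ x_m) < ∑ rk xᵢ`. -/
def Dependent {L : Type*} [Lattice L] [OrderBot L] (l : List L) : Prop :=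
  rk (join l) < (l.map rk).sum

theorem join_append {L : Type*} [Lattice L] [OrderBot L] (l l' : List L) :
    join (l ++ l') = join l ⊔ join l' := by
  induction l with
  | nil => simp [join]
  | cons a l ih =>
    simp only [join, List.cons_append, List.foldr_cons] at ih ⊢
    rw [ih, sup_assoc]

theorem rk_join_le {L : Type*} [Lattice L] [OrderBot L] [IsUpperModularLattice L] [Finite L]
    (l : List L) : rk (join l) ≤ (l.map rk).sum := by
  induction l with
  | nil => simp [join, rk_bot]
  | cons a l ih =>
    have := rk_sup_le a (join l)
    simp only [List.map_cons, List.sum_cons]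
    change rk (a ⊔ join l) ≤ _
    omega

theorem Dependent.append {L : Type*} [Lattice L] [OrderBot L] [IsUpperModularLattice L]
    [Finite L] {l l' : List L} (h : Dependent l ∨ Dependent l') : Dependent (l ++ l') := by
  have h1 := rk_sup_le (join l) (join l')
  have h2 := rk_join_le l
  have h3 := rk_join_le l'
  simp only [Dependent, join_append, List.map_append, List.sum_append] at h ⊢
  omega

/-! ### Complexes graded by a lattice -/

/-- A chain complex `V_n → ⋯ → V_0` of `R`-modules with a compatible `L`-grading, given by its
total module `M = ⨁ V_x` (`x ∈ L`): the submodules `V_x = comp x` are independent and span, and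
the differential maps `V_x` to `⨁_{y ⋖ x} V_y` (so it vanishes on `V_⊥`). The degree-`i` part is
`V_i = ⨁_{rk x = i} V_x`, see `LGradedComplex.deg`. -/
structure LGradedComplex (R L M : Type*) [Ring R] [PartialOrder L] [AddCommGroup M]
    [Module R M] where
  comp : L → Submodule R M
  indep : iSupIndep comp
  span : ⨆ x, comp x = ⊤
  diff : M →ₗ[R] M
  diff_mem : ∀ x, ∀ v ∈ comp x, diff v ∈ ⨆ y, ⨆ _ : y ⋖ x, comp y
  diff_diff : ∀ v, diff (diff v) = 0

namespace LGradedComplex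

/-- The degree-`i` part `V_i = ⨁_{rk x = i} V_x`. -/
def deg {R L M : Type*} [Ring R] [PartialOrder L] [AddCommGroup M] [Module R M]
    (V : LGradedComplex R L M) (i : ℕ) : Submodule R M :=
  ⨆ x, ⨆ _ : rk x = i, V.comp x

/-- Exactness of `V_n → ⋯ → V_1 → V_0`, i.e. `ker ∂_i = im ∂_{i+1}` for all `i ≥ 1`
(`∂_1` is not required to be onto). -/
def Acyclic {R L M : Type*} [Ring R] [PartialOrder L] [AddCommGroup M] [Module R M]
    (V : LGradedComplex R L M) : Prop :=
  ∀ i, 1 ≤ i → ∀ v ∈ V.deg i, V.diff v = 0 → ∃ w ∈ V.deg (i + 1), V.diff w = v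

/-- An `L`-homotopy: a contracting homotopy consisting of `d₀ : im ∂_1 → V_1` and of maps
`d_i : V_i → V_{i+1}`, `i ≥ 1`, with `d_i (V_x) ⊆ ⨁_{y ⋗ x} V_y`. The maps `d_i`, `i ≥ 1`, are
collected in one linear map `d`, whose values on `V_0` play no role. -/
structure LHomotopy {R L M : Type*} [Ring R] [PartialOrder L] [OrderBot L] [AddCommGroup M]
    [Module R M] (V : LGradedComplex R L M) where
  d₀ : (V.deg 1).map V.diff →ₗ[R] V.deg 1
  d : M →ₗ[R] M
  d_mem : ∀ x ≠ ⊥, ∀ v ∈ V.comp x, d v ∈ ⨆ y, ⨆ _ : x ⋖ y, V.comp y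
  homotopy_one : ∀ v (hv : v ∈ V.deg 1),
    (d₀ ⟨V.diff v, Submodule.mem_map_of_mem hv⟩ : M) + V.diff (d v) = v
  homotopy : ∀ i, 2 ≤ i → ∀ v ∈ V.deg i, d (V.diff v) + V.diff (d v) = v

/-- The complex formed by an independent family of submodules `p x` of an ambient module `E`
and an endomorphism of `E` that acts on them as a compatible differential; its total module is
the span of the family. -/
def ofFamily {R L E : Type*} [Ring R] [PartialOrder L] [AddCommGroup E] [Module R E]
    (p : L → Submodule R E) (hp : iSupIndep p) (f : E →ₗ[R] E)
    (hf : ∀ x, ∀ v ∈ p x, f v ∈ ⨆ y, ⨆ _ : y ⋖ x, p y)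
    (hff : ∀ x, ∀ v ∈ p x, f (f v) = 0) :
    LGradedComplex R L ↥(⨆ x, p x) where
  comp x := (p x).comap (⨆ x, p x).subtype
  indep := by
    rw [iSupIndep_def] at hp ⊢
    intro i
    rw [Submodule.disjoint_def]
    intro v hv hv'
    have h2 : (v : E) ∈ ⨆ (j) (_ : j ≠ i), p j := by
      have := Submodule.mem_map_of_mem (f := (⨆ x, p x).subtype) hv'
      simp only [Submodule.map_iSup] at this
      refine SetLike.le_def.1 (iSup₂_mono fun j _ => ?_) this
      exact Submodule.map_comap_le _ _
    exact Subtype.ext ((Submodule.disjoint_def.1 (hp i)) _ hv h2)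
  span := by
    apply Submodule.map_injective_of_injective (⨆ x, p x).injective_subtype
    rw [Submodule.map_iSup, Submodule.map_subtype_top]
    exact iSup_congr fun x => by
      rw [Submodule.map_comap_subtype, inf_eq_right]
      exact le_iSup p x
  diff := f.restrict (p := ⨆ x, p x) (q := ⨆ x, p x) (by
    intro v hv
    induction hv using Submodule.iSup_induction' with
    | mem x v hv =>
      have hle : (⨆ y, ⨆ _ : y ⋖ x, p y) ≤ ⨆ y, p y :=
        iSup_mono fun y => iSup_le fun _ => le_rfl
      exact hle (hf x v hv)
    | zero => simp
    | add v w _ _ h h' => rw [map_add]; exact add_mem h h')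
  diff_mem := by
    intro x v hv
    have h := hf x v hv
    have hinj : Function.Injective (⨆ x, p x).subtype := (⨆ x, p x).injective_subtype
    rw [← Submodule.comap_map_eq_of_injective hinj (⨆ y, ⨆ _ : y ⋖ x, _), Submodule.mem_comap]
    simp only [Submodule.map_iSup]
    have e : ∀ y, ((p y).comap (⨆ x, p x).subtype).map (⨆ x, p x).subtype = p y := fun y => by
      rw [Submodule.map_comap_subtype, inf_eq_right]
      exact le_iSup p y
    simp only [e]
    exact h
  diff_diff := by
    rintro ⟨v, hv⟩
    apply Subtype.ext
    change f (f v) = 0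
    induction hv using Submodule.iSup_induction' with
    | mem x v hv => exact hff x v hv
    | zero => simp
    | add v w _ _ h h' => simp [h, h']

/-- The subcomplex `V_{≤ x} = ⨁_{y ≤ x} V_y`, graded by the lower interval `L_{≤ x}`. -/
def lower {R L M : Type*} [Ring R] [PartialOrder L] [AddCommGroup M] [Module R M]
    (V : LGradedComplex R L M) (x : L) :
    LGradedComplex R (Set.Iic x) ↥(⨆ y : Set.Iic x, V.comp y) :=
  ofFamily (fun y : Set.Iic x => V.comp y) (V.indep.comp Subtype.val_injective) V.diff
    (by
      intro y v hv
      refine SetLike.le_def.1 (iSup₂_le fun z hz => ?_) (V.diff_mem y v hv)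
      have hzx : z ∈ Set.Iic x := hz.le.trans y.2
      refine le_iSup₂_of_le (⟨z, hzx⟩ : Set.Iic x) ?_ le_rfl
      exact ⟨hz.lt, fun c h h' => hz.2 (c := c.1) h h'⟩)
    (fun _ v _ => V.diff_diff v)

/-- `V` is `L`-contractible: for every `x ∈ L` the complex `V_{≤ x}` admits an `L`-homotopy. -/
def LContractible {R L M : Type*} [Ring R] [PartialOrder L] [OrderBot L] [AddCommGroup M]
    [Module R M] (V : LGradedComplex R L M) : Prop :=
  ∀ x : L, Nonempty (V.lower x).LHomotopy

end LGradedComplex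

/-! ### Minimal complexes -/

/-- An atomic datum: submodules `U_a` of a module `U = U_0`, one for each atom `a` of `L`. -/
structure AtomicDatum (R L U : Type*) [Ring R] [PartialOrder L] [OrderBot L] [AddCommGroup U]
    [Module R U] where
  sub : ∀ a : L, IsAtom a → Submodule R U

section Minimal

variable {R L U : Type*} [Ring R] [Fintype L] [AddCommGroup U] [Module R U]

open Classical in
/-- An injective map which marks a function on words in `L` by the letter `x`:
`(tag x g) (x :: c) = g c`, and `tag x g` vanishes on all other words. -/
def tag (R : Type*) {L U : Type*} [Ring R] [AddCommGroup U] [Module R U] (x : L) :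
    (List L → U) →ₗ[R] (List L → U) where
  toFun g l := match l with
    | [] => 0
    | y :: c => if y = x then g c else 0
  map_add' g h := by
    funext l
    rcases l with _ | ⟨y, c⟩
    · simp
    · by_cases h : y = x <;> simp [h]
  map_smul' r g := by
    funext l
    rcases l with _ | ⟨y, c⟩
    · simp
    · by_cases h : y = x <;> simp [h]

/-- The map which removes the marks: `untag (tag x g) = g` for all `x` and `g`. -/
def untag (R L U : Type*) [Ring R] [Fintype L] [AddCommGroup U] [Module R U] :
    (List L → U) →ₗ[R] (List L → U) where
  toFun f c := ∑ y, f (y :: c)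
  map_add' f g := by funext c; simp [Finset.sum_add_distrib]
  map_smul' r f := by funext c; simp [Finset.smul_sum]

open Classical in
/-- The copy of `U` formed by the functions supported at the empty word. -/
def base (R L U : Type*) [Ring R] [AddCommGroup U] [Module R U] : U →ₗ[R] (List L → U) :=
  LinearMap.single R (fun _ : List L => U) []

theorem untag_tag (x : L) (g : List L → U) : untag R L U (tag R x g) = g := by
  classical
  funext c
  simp [untag, tag]

theorem untag_base (u : U) : untag R L U (base R L U u) = 0 := by
  classical
  funext c
  simp [untag, base]

variable [Lattice L] [OrderBot L]

open Classical in
/-- The components `V_x` of the minimal complex of an atomic datum `D`, realized as submodules of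
one ambient module: `V_⊥` is (a copy of) `U`, `V_a` is (a copy of) `U_a` for an atom `a`, and for
`rk x > 1` the component `V_x` is (a copy, marked by `x`, of) the kernel of the differential
`untag` on `⨁_{y ⋖ x} V_y`. On `V_a` and `V_x` the differential removes the mark, i.e. it is the
inclusion `U_a → U`, respectively the inclusion of the kernel into `⨁_{y ⋖ x} V_y`. -/
def minimalComp (D : AtomicDatum R L U) (x : L) : Submodule R (List L → U) :=
  if x = ⊥ then LinearMap.range (base R L U)
  else if h : IsAtom x then ((D.sub x h).map (base R L U)).map (tag R x)
  else (LinearMap.ker (untag R L U) ⊓ ⨆ y : {y : L // y ⋖ x}, minimalComp D y.1).map (tag R x)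
termination_by WellFounded.wrap (wellFounded_lt (α := L)) x
decreasing_by exact y.2.lt

theorem minimalComp_bot (D : AtomicDatum R L U) :
    minimalComp D ⊥ = LinearMap.range (base R L U) := by
  rw [minimalComp, if_pos rfl]

theorem minimalComp_atom (D : AtomicDatum R L U) {a : L} (ha : IsAtom a) :
    minimalComp D a = ((D.sub a ha).map (base R L U)).map (tag R a) := by
  rw [minimalComp, if_neg ha.1, dif_pos ha]

theorem minimalComp_of_not_atom (D : AtomicDatum R L U) {x : L} (hx : x ≠ ⊥)
    (hx' : ¬ IsAtom x) :
    minimalComp D x = (LinearMap.ker (untag R L U) ⊓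
      ⨆ y : {y : L // y ⋖ x}, minimalComp D y.1).map (tag R x) := by
  rw [minimalComp, if_neg hx, dif_neg hx']

theorem minimalComp_apply (D : AtomicDatum R L U) {x : L} {f : List L → U}
    (hf : f ∈ minimalComp D x) (l : List L) (hl : l.headD ⊥ ≠ x) : f l = 0 := by
  classical
  by_cases hx : x = ⊥
  · subst hx
    rw [minimalComp_bot] at hf
    obtain ⟨u, rfl⟩ := hf
    rcases l with _ | ⟨y, c⟩
    · simp at hl
    · simp [base]
  · obtain ⟨g, rfl⟩ : ∃ g, tag R x g = f := by
      by_cases h : IsAtom x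
      · rw [minimalComp_atom D h] at hf
        obtain ⟨g, _, hg⟩ := hf
        exact ⟨g, hg⟩
      · rw [minimalComp_of_not_atom D hx h] at hf
        obtain ⟨g, _, hg⟩ := hf
        exact ⟨g, hg⟩
    rcases l with _ | ⟨y, c⟩
    · simp [tag]
    · have : y ≠ x := by simpa using hl
      simp [tag, this]

/-- The minimal complex `𝒪(D, L)` of an atomic datum `D`. -/
def minimalComplex (D : AtomicDatum R L U) :
    LGradedComplex R L ↥(⨆ x, minimalComp D x) :=
  LGradedComplex.ofFamily (minimalComp D)
    (by
      rw [iSupIndep_def]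
      intro i
      rw [Submodule.disjoint_def]
      intro f hf hf'
      funext l
      by_cases hl : l.headD ⊥ = i
      · have : ∀ j, j ≠ i → minimalComp D j ≤
            LinearMap.ker (LinearMap.proj (R := R) (φ := fun _ : List L => U) l) := by
          intro j hj g hg
          exact minimalComp_apply D hg l (hl.trans_ne hj.symm)
        exact SetLike.le_def.1 (iSup₂_le this) hf'
      · exact minimalComp_apply D hf l hl)
    (untag R L U)
    (by
      intro x v hv
      by_cases hx : x = ⊥
      · subst hx
        rw [minimalComp_bot] at hv
        obtain ⟨u, rfl⟩ := hv
        rw [untag_base]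
        exact zero_mem _
      by_cases h : IsAtom x
      · rw [minimalComp_atom D h] at hv
        obtain ⟨_, ⟨u, _, rfl⟩, rfl⟩ := hv
        rw [untag_tag]
        refine SetLike.le_def.1 (le_iSup₂_of_le (f := fun y (_ : y ⋖ x) => minimalComp D y)
          (⊥ : L) h.bot_covBy le_rfl) (?_ : _ ∈ minimalComp D ⊥)
        rw [minimalComp_bot]
        exact ⟨u, rfl⟩
      · rw [minimalComp_of_not_atom D hx h] at hv
        obtain ⟨g, hg, rfl⟩ := hv
        rw [untag_tag, iSup_subtype']
        exact hg.2)
    (by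
      intro x v hv
      by_cases hx : x = ⊥
      · subst hx
        rw [minimalComp_bot] at hv
        obtain ⟨u, rfl⟩ := hv
        rw [untag_base, map_zero]
      by_cases h : IsAtom x
      · rw [minimalComp_atom D h] at hv
        obtain ⟨_, ⟨u, _, rfl⟩, rfl⟩ := hv
        rw [untag_tag, untag_base]
      · rw [minimalComp_of_not_atom D hx h] at hv
        obtain ⟨g, hg, rfl⟩ := hv
        rw [untag_tag]
        exact hg.1)

/-- The identification of `U` with the degree-`0` part of the minimal complex. -/
def minimalBase (D : AtomicDatum R L U) : U →ₗ[R] ↥(⨆ x, minimalComp D x) :=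
  (base R L U).codRestrict _ (fun u => (le_iSup (minimalComp D) ⊥)
    (by rw [minimalComp_bot]; exact ⟨u, rfl⟩))

end Minimal

/-! ### The universal supercommutative algebra `S(V)` -/

section Super

set_option linter.unusedSectionVars false

variable {K L M : Type*} [Field K] [Lattice L] [AddCommGroup M] [Module K M]

/-- The relations `u v = (-1)^{ij} v u` for `u ∈ V_i`, `v ∈ V_j`. -/
inductive SuperRel (V : LGradedComplex K L M) : TensorAlgebra K M → TensorAlgebra K M → Prop
  | comm (i j : ℕ) (u v : M) (hu : u ∈ V.deg i) (hv : v ∈ V.deg j) :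
      SuperRel V (TensorAlgebra.ι K u * TensorAlgebra.ι K v)
        ((-1 : K) ^ (i * j) • (TensorAlgebra.ι K v * TensorAlgebra.ι K u))

/-- The universal supercommutative algebra `S(V)`. -/
def SuperSym (V : LGradedComplex K L M) : Type _ := RingQuot (SuperRel V)

instance (V : LGradedComplex K L M) : Ring (SuperSym V) :=
  inferInstanceAs (Ring (RingQuot (SuperRel V)))

instance (V : LGradedComplex K L M) : Algebra K (SuperSym V) :=
  inferInstanceAs (Algebra K (RingQuot (SuperRel V)))

/-- The projection from the tensor algebra to `S(V)`. -/
def superMk (V : LGradedComplex K L M) : TensorAlgebra K M →ₐ[K] SuperSym V :=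
  RingQuot.mkAlgHom K (SuperRel V)

/-- The canonical map `V → S(V)`. -/
def sι (V : LGradedComplex K L M) : M →ₗ[K] SuperSym V :=
  (superMk V).toLinearMap ∘ₗ TensorAlgebra.ι K

theorem sι_comm (V : LGradedComplex K L M) {i j : ℕ} {u v : M} (hu : u ∈ V.deg i)
    (hv : v ∈ V.deg j) : sι V u * sι V v = (-1 : K) ^ (i * j) • (sι V v * sι V u) := by
  have : superMk V _ = superMk V _ :=
    RingQuot.mkAlgHom_rel K (SuperRel.comm (V := V) i j u v hu hv)
  simpa [sι] using this

/-- The universal property of `S(V)`. -/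
def superLift (V : LGradedComplex K L M) {A : Type*} [Ring A] [Algebra K A] (f : M →ₗ[K] A)
    (hf : ∀ i j u v, u ∈ V.deg i → v ∈ V.deg j → f u * f v = (-1 : K) ^ (i * j) • (f v * f u)) :
    SuperSym V →ₐ[K] A :=
  RingQuot.liftAlgHom K ⟨TensorAlgebra.lift K f, by
    rintro _ _ ⟨i, j, u, v, hu, hv⟩
    simpa using hf i j u v hu hv⟩

theorem superLift_ι (V : LGradedComplex K L M) {A : Type*} [Ring A] [Algebra K A]
    (f : M →ₗ[K] A)
    (hf : ∀ i j u v, u ∈ V.deg i → v ∈ V.deg j → f u * f v = (-1 : K) ^ (i * j) • (f v * f u))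
    (v : M) : superLift V f hf (sι V v) = f v :=
  (RingQuot.liftAlgHom_mkAlgHom_apply K _ _ _).trans (TensorAlgebra.lift_ι_apply f v)

theorem super_induction (V : LGradedComplex K L M) {P : SuperSym V → Prop}
    (h0 : ∀ r : K, P (algebraMap K _ r)) (h1 : ∀ v, P (sι V v))
    (hmul : ∀ a b, P a → P b → P (a * b)) (hadd : ∀ a b, P a → P b → P (a + b))
    (s : SuperSym V) : P s := by
  obtain ⟨t, rfl⟩ : ∃ t, superMk V t = s :=
    RingQuot.mkAlgHom_surjective K (SuperRel V) s
  induction t using TensorAlgebra.induction with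
  | algebraMap r => rw [AlgHom.commutes]; exact h0 r
  | ι x => exact h1 x
  | mul x y hx hy => rw [map_mul]; exact hmul _ _ hx hy
  | add x y hx hy => rw [map_add]; exact hadd _ _ hx hy

open Classical in
/-- The decomposition `V = ⨁ V_x`. -/
def decomp (V : LGradedComplex K L M) : (DirectSum L fun x => V.comp x) ≃ₗ[K] M :=
  LinearEquiv.ofBijective (DirectSum.coeLinearMap V.comp)
    (by
      have h : DirectSum.IsInternal V.comp :=
        (DirectSum.isInternal_submodule_iff_iSupIndep_and_iSup_eq_top V.comp).2
          ⟨V.indep, V.span⟩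
      exact h)

open Classical in
/-- The parity involution of `V`, which is `(-1)^i` on `V_i`. -/
def parity (V : LGradedComplex K L M) : M →ₗ[K] M :=
  (DirectSum.toModule K L M fun x => (-1 : K) ^ rk x • (V.comp x).subtype) ∘ₗ
    (decomp V).symm.toLinearMap

theorem parity_comp (V : LGradedComplex K L M) {x : L} {v : M} (hv : v ∈ V.comp x) :
    parity V v = (-1 : K) ^ rk x • v := by
  classical
  have h : (decomp V).symm v = DirectSum.lof K L (fun x => V.comp x) x ⟨v, hv⟩ := by
    rw [LinearEquiv.symm_apply_eq]
    exact (DirectSum.coeLinearMap_lof V.comp x ⟨v, hv⟩).symm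
  simp only [parity, LinearMap.comp_apply, LinearEquiv.coe_coe]
  rw [h]
  refine (DirectSum.toModule_lof K x _).trans ?_
  simp

theorem deg_induction (V : LGradedComplex K L M) {i : ℕ} {p : M → Prop}
    (h : ∀ x v, rk x = i → v ∈ V.comp x → p v) (h0 : p 0)
    (hadd : ∀ a b, p a → p b → p (a + b)) {v : M} (hv : v ∈ V.deg i) : p v := by
  refine Submodule.iSup_induction _ (motive := p) hv (fun x w hw => ?_) h0 hadd
  by_cases hx : rk x = i
  · rw [iSup_pos hx] at hw
    exact h x w hx hw
  · rw [iSup_neg hx] at hw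
    rw [(Submodule.mem_bot K).1 hw]
    exact h0

theorem comp_le_deg (V : LGradedComplex K L M) (x : L) : V.comp x ≤ V.deg (rk x) :=
  le_iSup₂_of_le x rfl le_rfl

theorem parity_deg (V : LGradedComplex K L M) {i : ℕ} {v : M} (hv : v ∈ V.deg i) :
    parity V v = (-1 : K) ^ i • v := by
  refine deg_induction V (p := fun w => parity V w = (-1 : K) ^ i • w) (fun x w hx hw => ?_) (by simp) (fun a b ha hb => ?_) hv
  · rw [parity_comp V hw, hx]
  · rw [map_add, ha, hb, smul_add]

theorem sι_parity_comm (V : LGradedComplex K L M) {i j : ℕ} {u v : M} (hu : u ∈ V.deg i)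
    (hv : v ∈ V.deg j) : sι V (parity V u) * sι V (parity V v) =
      (-1 : K) ^ (i * j) • (sι V (parity V v) * sι V (parity V u)) := by
  simp only [parity_deg V hu, parity_deg V hv, map_smul, smul_mul_smul_comm,
    sι_comm V hu hv, smul_smul]
  congr 1
  ring

/-- The parity automorphism of `S(V)`. -/
def superParity (V : LGradedComplex K L M) : SuperSym V →ₐ[K] SuperSym V :=
  superLift V (sι V ∘ₗ parity V) (fun _ _ _ _ hu hv => sι_parity_comm V hu hv)

theorem superParity_ι (V : LGradedComplex K L M) (v : M) :
    superParity V (sι V v) = sι V (parity V v) :=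
  superLift_ι V _ _ v

theorem superParity_superParity (V : LGradedComplex K L M) (s : SuperSym V) :
    superParity V (superParity V s) = s := by
  have hpar : ∀ v, parity V (parity V v) = v := by
    intro v
    have hv : v ∈ ⨆ x, V.comp x := by rw [V.span]; trivial
    refine Submodule.iSup_induction _ (motive := fun v => parity V (parity V v) = v) hv
      (fun x w hw => ?_) (by simp) (fun a b ha hb => ?_)
    · rw [parity_comp V hw, map_smul, parity_comp V hw, smul_smul, ← pow_add,
        Even.neg_one_pow ⟨_, rfl⟩, one_smul]
    · rw [map_add, map_add, ha, hb]
  induction s using super_induction with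
  | h0 r => simp
  | h1 v => simp [superParity_ι, hpar]
  | hmul a b ha hb => simp [ha, hb]
  | hadd a b ha hb => simp [ha, hb]

variable [OrderBot L] [IsUpperModularLattice L] [Finite L]

theorem diff_deg_succ (V : LGradedComplex K L M) {i : ℕ} {v : M} (hv : v ∈ V.deg (i + 1)) :
    V.diff v ∈ V.deg i := by
  refine deg_induction V (p := fun w => V.diff w ∈ V.deg i) (fun x w hx hw => ?_) (by simp) (fun a b ha hb => ?_) hv
  · refine SetLike.le_def.1 (iSup₂_le fun y hy => ?_) (V.diff_mem x w hw)
    have := rk_covBy hy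
    exact le_iSup₂_of_le y (by omega) le_rfl
  · rw [map_add]; exact add_mem ha hb

theorem diff_deg_zero (V : LGradedComplex K L M) {v : M} (hv : v ∈ V.deg 0) :
    V.diff v = 0 := by
  refine deg_induction V (p := fun w => V.diff w = 0) (fun x w hx hw => ?_) (by simp) (fun a b ha hb => ?_) hv
  · rw [← Submodule.mem_bot K]
    refine SetLike.le_def.1 (iSup₂_le fun y hy => ?_) (V.diff_mem x w hw)
    have := rk_covBy hy
    omega
  · rw [map_add, ha, hb, add_zero]

theorem parity_diff (V : LGradedComplex K L M) (v : M) :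
    parity V (V.diff v) = - V.diff (parity V v) := by
  have hv : v ∈ ⨆ x, V.comp x := by rw [V.span]; trivial
  refine Submodule.iSup_induction _
    (motive := fun w => parity V (V.diff w) = - V.diff (parity V w)) hv (fun x w hw => ?_) (by simp) (fun a b ha hb => ?_)
  · have hd := comp_le_deg V x hw
    rw [parity_deg V hd]
    rcases h : rk x with _ | i
    · rw [h] at hd
      simp [diff_deg_zero V hd]
    · rw [h] at hd
      rw [parity_deg V (diff_deg_succ V hd), map_smul, pow_succ]
      simp
  · rw [map_add, map_add, map_add, map_add, ha, hb, neg_add]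

/-- The super-derivation property is encoded by the algebra homomorphism
`a ↦ (σ a, ∂ a; 0, a)` to upper triangular matrices, with `σ` the parity automorphism. -/
def superMat (V : LGradedComplex K L M) : SuperSym V →ₐ[K] Matrix (Fin 2) (Fin 2) (SuperSym V) :=
  superLift V
    { toFun := fun v => !![sι V (parity V v), sι V (V.diff v); 0, sι V v]
      map_add' := by intro v w; ext i j; fin_cases i <;> fin_cases j <;> simp
      map_smul' := by intro r v; ext i j; fin_cases i <;> fin_cases j <;> simp }
    (by
      intro i j u v hu hv
      have key : (-1 : K) ^ i • (sι V u * sι V (V.diff v)) + sι V (V.diff u) * sι V v =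
          (-1 : K) ^ (i * j) • ((-1 : K) ^ j • (sι V v * sι V (V.diff u)) +
            sι V (V.diff v) * sι V u) := by
        have h1 : sι V (V.diff u) * sι V v =
            (-1 : K) ^ (i * j + j) • (sι V v * sι V (V.diff u)) := by
          rcases i with _ | i
          · simp [diff_deg_zero V hu]
          · rw [sι_comm V (diff_deg_succ V hu) hv]
            congr 1
            rw [show (i + 1) * j + j = i * j + (j + j) by ring, pow_add _ _ (j + j),
              Even.neg_one_pow ⟨j, rfl⟩, mul_one]
        have h2 : (-1 : K) ^ i • (sι V u * sι V (V.diff v)) =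
            (-1 : K) ^ (i * j) • (sι V (V.diff v) * sι V u) := by
          rcases j with _ | j
          · simp [diff_deg_zero V hv]
          · rw [sι_comm V hu (diff_deg_succ V hv), smul_smul]
            congr 1
            rw [← pow_add]
            congr 1
            ring
        rw [h1, h2, smul_add, smul_smul, ← pow_add, add_comm]
      ext a b
      fin_cases a <;> fin_cases b
      · simpa [Matrix.mul_apply, Fin.sum_univ_two] using sι_parity_comm V hu hv
      · simpa [Matrix.mul_apply, Fin.sum_univ_two, parity_deg V hu, parity_deg V hv] using key
      · simp [Matrix.mul_apply, Fin.sum_univ_two]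
      · simpa [Matrix.mul_apply, Fin.sum_univ_two] using sι_comm V hu hv)

/-- The differential of `S(V)`: the unique super-derivation which extends `∂`. -/
def superDiff (V : LGradedComplex K L M) : SuperSym V →ₗ[K] SuperSym V where
  toFun s := superMat V s 0 1
  map_add' a b := by simp
  map_smul' r a := by simp

theorem superMat_ι (V : LGradedComplex K L M) (v : M) :
    superMat V (sι V v) = !![sι V (parity V v), sι V (V.diff v); 0, sι V v] :=
  superLift_ι V _ _ v

theorem superMat_apply (V : LGradedComplex K L M) (s : SuperSym V) :
    superMat V s 0 0 = superParity V s ∧ superMat V s 1 0 = 0 ∧ superMat V s 1 1 = s := by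
  induction s using super_induction with
  | h0 r => simp [Algebra.algebraMap_eq_smul_one]
  | h1 v => simp [superMat_ι, superParity_ι]
  | hmul a b ha hb => simp [Matrix.mul_apply, Fin.sum_univ_two, ha, hb]
  | hadd a b ha hb => simp [ha, hb]

theorem superDiff_ι (V : LGradedComplex K L M) (v : M) :
    superDiff V (sι V v) = sι V (V.diff v) := by
  simp [superDiff, superMat_ι]

theorem superDiff_algebraMap (V : LGradedComplex K L M) (r : K) :
    superDiff V (algebraMap K _ r) = 0 := by
  simp [superDiff, Algebra.algebraMap_eq_smul_one]

theorem superDiff_mul (V : LGradedComplex K L M) (a b : SuperSym V) :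
    superDiff V (a * b) = superDiff V a * b + superParity V a * superDiff V b := by
  obtain ⟨h1, h2, h3⟩ := superMat_apply V a
  obtain ⟨h1', h2', h3'⟩ := superMat_apply V b
  change superMat V (a * b) 0 1 = superMat V a 0 1 * b + superParity V a * superMat V b 0 1
  rw [map_mul, Matrix.mul_apply, Fin.sum_univ_two, h1, h3', add_comm]

theorem superDiff_parity (V : LGradedComplex K L M) (s : SuperSym V) :
    superDiff V (superParity V s) = - superParity V (superDiff V s) := by
  induction s using super_induction with
  | h0 r => simp [superDiff_algebraMap]
  | h1 v => simp [superDiff_ι, superParity_ι, parity_diff]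
  | hmul a b ha hb =>
    simp only [superDiff_mul, ha, hb, map_mul, map_add, superParity_superParity]
    rw [neg_mul, mul_neg, neg_add]
  | hadd a b ha hb => simp [ha, hb, add_comm]

theorem superDiff_superDiff (V : LGradedComplex K L M) (s : SuperSym V) :
    superDiff V (superDiff V s) = 0 := by
  induction s using super_induction with
  | h0 r => simp [superDiff_algebraMap]
  | h1 v => simp [superDiff_ι, V.diff_diff]
  | hmul a b ha hb =>
    simp [superDiff_mul, ha, hb, superDiff_parity]
  | hadd a b ha hb => simp [ha, hb]


/-! ### The generalized Orlik-Solomon algebra -/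

/-- Words `r₁ ⋯ r_m` in homogeneous elements: lists of pairs `(xᵢ, rᵢ)` with `rᵢ ∈ V_{xᵢ}`. -/
def IsWord (V : LGradedComplex K L M) (w : List (L × M)) : Prop := ∀ p ∈ w, p.2 ∈ V.comp p.1

/-- The product `r₁ ⋯ r_m` in `S(V)` of a word. -/
def wordProd (V : LGradedComplex K L M) (w : List (L × M)) : SuperSym V :=
  (w.map fun p => sι V p.2).prod

/-- The component `S_x` of the `L`-grading of `S(V)`, spanned by the products `r₁ ⋯ r_m` with
`rᵢ ∈ V_{xᵢ}` and `x₁ ∨ ⋯ ∨ x_m = x`. -/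
def superComp (V : LGradedComplex K L M) (x : L) : Submodule K (SuperSym V) :=
  Submodule.span K {s | ∃ w, IsWord V w ∧ join (w.map Prod.fst) = x ∧ s = wordProd V w}

/-- The degree-`i` part of `S(V)`, spanned by the products `r₁ ⋯ r_m` with `rᵢ ∈ V_{xᵢ}` and
`rk x₁ + ⋯ + rk x_m = i`. -/
def superDeg (V : LGradedComplex K L M) (i : ℕ) : Submodule K (SuperSym V) :=
  Submodule.span K {s | ∃ w, IsWord V w ∧ (w.map fun p => rk p.1).sum = i ∧ s = wordProd V w}

/-- The space `I`, spanned by the products `r₁ ⋯ r_m` with `rᵢ ∈ V_{xᵢ}` for dependent families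
`x₁, …, x_m`. -/
def depIdeal (V : LGradedComplex K L M) : Submodule K (SuperSym V) :=
  Submodule.span K {s | ∃ w, IsWord V w ∧ Dependent (w.map Prod.fst) ∧ s = wordProd V w}

theorem mem_span_words (V : LGradedComplex K L M) (s : SuperSym V) :
    s ∈ Submodule.span K {s | ∃ w, IsWord V w ∧ s = wordProd V w} := by
  induction s using super_induction with
  | h0 r =>
    rw [Algebra.algebraMap_eq_smul_one]
    exact Submodule.smul_mem _ _ (Submodule.subset_span ⟨[], by simp [IsWord], by simp [wordProd]⟩)
  | h1 v =>
    have hv : v ∈ ⨆ x, V.comp x := by rw [V.span]; trivial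
    refine Submodule.iSup_induction _ (motive := fun w => sι V w ∈ Submodule.span K
      {s | ∃ w, IsWord V w ∧ s = wordProd V w}) hv (fun x w hw => ?_) (by simp)
      (fun a b ha hb => ?_)
    · exact Submodule.subset_span ⟨[(x, w)], by simpa [IsWord] using hw, by simp [wordProd]⟩
    · rw [map_add]; exact add_mem ha hb
  | hmul a b ha hb =>
    have := Submodule.mul_mem_mul ha hb
    rw [Submodule.span_mul_span] at this
    refine Submodule.span_mono ?_ this
    rintro _ ⟨_, ⟨w, hw, rfl⟩, _, ⟨w', hw', rfl⟩, rfl⟩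
    refine ⟨w ++ w', ?_, by simp [wordProd]⟩
    intro p hp
    rcases List.mem_append.1 hp with h | h
    · exact hw p h
    · exact hw' p h
  | hadd a b ha hb => exact add_mem ha hb

theorem mul_mem_depIdeal (V : LGradedComplex K L M) {a b : SuperSym V}
    (h : a ∈ depIdeal V ∨ b ∈ depIdeal V) : a * b ∈ depIdeal V := by
  have key : ∀ w w' : List (L × M), IsWord V w → IsWord V w' →
      Dependent (w.map Prod.fst) ∨ Dependent (w'.map Prod.fst) →
      wordProd V w * wordProd V w' ∈ depIdeal V := by
    intro w w' hw hw' h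
    refine Submodule.subset_span ⟨w ++ w', ?_, ?_, by simp [wordProd]⟩
    · intro p hp
      rcases List.mem_append.1 hp with h | h
      · exact hw p h
      · exact hw' p h
    · rw [List.map_append]; exact Dependent.append h
  rcases h with h | h
  · have := Submodule.mul_mem_mul h (mem_span_words V b)
    rw [depIdeal, Submodule.span_mul_span] at this
    refine Submodule.span_le.2 ?_ this
    rintro _ ⟨_, ⟨w, hw, hd, rfl⟩, _, ⟨w', hw', rfl⟩, rfl⟩
    exact key w w' hw hw' (Or.inl hd)
  · have := Submodule.mul_mem_mul (mem_span_words V a) h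
    rw [depIdeal, Submodule.span_mul_span] at this
    refine Submodule.span_le.2 ?_ this
    rintro _ ⟨_, ⟨w, hw, rfl⟩, _, ⟨w', hw', hd, rfl⟩, rfl⟩
    exact key w w' hw hw' (Or.inr hd)

theorem superParity_word (V : LGradedComplex K L M) {w : List (L × M)} (hw : IsWord V w) :
    ∃ c : K, superParity V (wordProd V w) = c • wordProd V w := by
  induction w with
  | nil => exact ⟨1, by simp [wordProd]⟩
  | cons p w ih =>
    obtain ⟨c, hc⟩ := ih (fun q hq => hw q (List.mem_cons_of_mem _ hq))
    have hp := hw p List.mem_cons_self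
    refine ⟨(-1 : K) ^ rk p.1 * c, ?_⟩
    have e : wordProd V (p :: w) = sι V p.2 * wordProd V w := by simp [wordProd]
    rw [e, map_mul, hc, superParity_ι, parity_comp V hp, map_smul, smul_mul_smul_comm]

theorem superParity_mem (V : LGradedComplex K L M) {s : SuperSym V} (hs : s ∈ depIdeal V) :
    superParity V s ∈ depIdeal V := by
  have : depIdeal V ≤ (depIdeal V).comap (superParity V).toLinearMap := by
    refine Submodule.span_le.2 ?_
    rintro _ ⟨w, hw, hd, rfl⟩
    obtain ⟨c, hc⟩ := superParity_word V hw
    change superParity V (wordProd V w) ∈ depIdeal V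
    rw [hc]
    exact Submodule.smul_mem _ _ (Submodule.subset_span ⟨w, hw, hd, rfl⟩)
  exact this hs

/-- The differential ideal `𝓘(L, V) = I + ∂ I` of `S(V)`. -/
def osIdeal (V : LGradedComplex K L M) : Ideal (SuperSym V) where
  carrier := {s | s ∈ depIdeal V ⊔ (depIdeal V).map (superDiff V)}
  add_mem' ha hb := (depIdeal V ⊔ (depIdeal V).map (superDiff V)).add_mem ha hb
  zero_mem' := zero_mem (depIdeal V ⊔ (depIdeal V).map (superDiff V))
  smul_mem' := by
    intro c a ha
    obtain ⟨i, hi, _, ⟨j, hj, rfl⟩, rfl⟩ := Submodule.mem_sup.1 ha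
    have e : c * (i + superDiff V j) = (c * i - superDiff V (superParity V c) * j) +
        superDiff V (superParity V c * j) := by
      rw [superDiff_mul, superParity_superParity]; noncomm_ring
    change c * (i + superDiff V j) ∈ depIdeal V ⊔ (depIdeal V).map (superDiff V)
    rw [e]
    exact Submodule.add_mem_sup
      (sub_mem (mul_mem_depIdeal V (Or.inr hi)) (mul_mem_depIdeal V (Or.inr hj)))
      ⟨_, mul_mem_depIdeal V (Or.inr hj), rfl⟩

theorem mem_osIdeal (V : LGradedComplex K L M) {s : SuperSym V} :
    s ∈ osIdeal V ↔ s ∈ depIdeal V ⊔ (depIdeal V).map (superDiff V) := Iff.rfl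

instance osIdeal_isTwoSided (V : LGradedComplex K L M) : (osIdeal V).IsTwoSided where
  mul_mem_of_left := by
    intro a b ha
    rw [mem_osIdeal] at ha ⊢
    obtain ⟨i, hi, _, ⟨j, hj, rfl⟩, rfl⟩ := Submodule.mem_sup.1 ha
    have e : (i + superDiff V j) * b = (i * b - superParity V j * superDiff V b) +
        superDiff V (j * b) := by
      rw [superDiff_mul]; noncomm_ring
    rw [e]
    exact Submodule.add_mem_sup
      (sub_mem (mul_mem_depIdeal V (Or.inl hi))
        (mul_mem_depIdeal V (Or.inl (superParity_mem V hj))))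
      ⟨_, mul_mem_depIdeal V (Or.inl hj), rfl⟩

theorem superDiff_mem_osIdeal (V : LGradedComplex K L M) {s : SuperSym V} (hs : s ∈ osIdeal V) :
    superDiff V s ∈ osIdeal V := by
  rw [mem_osIdeal] at hs ⊢
  obtain ⟨i, hi, _, ⟨j, hj, rfl⟩, rfl⟩ := Submodule.mem_sup.1 hs
  rw [map_add, superDiff_superDiff, add_zero]
  exact Submodule.mem_sup_right ⟨i, hi, rfl⟩

/-- The generalized Orlik-Solomon algebra `S(V) / 𝓘(L, V)`. -/
abbrev OSAlgebra (V : LGradedComplex K L M) : Type _ := SuperSym V ⧸ osIdeal V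

/-- The projection `S(V) → S(V) / 𝓘(L, V)`. -/
def osMk (V : LGradedComplex K L M) : SuperSym V →ₐ[K] OSAlgebra V :=
  Ideal.Quotient.mkₐ K (osIdeal V)

/-- The differential of the generalized Orlik-Solomon algebra, induced by that of `S(V)`. -/
def osDiff (V : LGradedComplex K L M) : OSAlgebra V →ₗ[K] OSAlgebra V where
  toFun := QuotientAddGroup.map (osIdeal V).toAddSubgroup (osIdeal V).toAddSubgroup
    (superDiff V).toAddMonoidHom (fun _ hs => superDiff_mem_osIdeal V hs)
  map_add' a b := map_add _ a b
  map_smul' r a := by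
    obtain ⟨s, rfl⟩ := Ideal.Quotient.mkₐ_surjective K (osIdeal V) a
    exact congrArg (osMk V) ((superDiff V).map_smul r s)

theorem osDiff_mk (V : LGradedComplex K L M) (s : SuperSym V) :
    osDiff V (osMk V s) = osMk V (superDiff V s) := rfl

/-- The component of the generalized Orlik-Solomon algebra at `x ∈ L`: the image of `S_x`. -/
def osComp (V : LGradedComplex K L M) (x : L) : Submodule K (OSAlgebra V) :=
  (superComp V x).map (osMk V).toLinearMap

/-- The degree-`i` part of the generalized Orlik-Solomon algebra. -/
def osDeg (V : LGradedComplex K L M) (i : ℕ) : Submodule K (OSAlgebra V) :=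
  (superDeg V i).map (osMk V).toLinearMap

theorem sι_mem_center (V : LGradedComplex K L M) {v : M} (hv : v ∈ V.comp ⊥) :
    sι V v ∈ Subalgebra.center K (SuperSym V) := by
  have hv0 : v ∈ V.deg 0 := by
    have := comp_le_deg V ⊥ hv
    rwa [rk_bot] at this
  rw [Subalgebra.mem_center_iff]
  intro b
  induction b using super_induction with
  | h0 r => exact Algebra.commutes r _
  | h1 w =>
    have hw : w ∈ ⨆ x, V.comp x := by rw [V.span]; trivial
    refine Submodule.iSup_induction _ (motive := fun w => sι V w * sι V v = sι V v * sι V w) hw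
      (fun x w hw => ?_) (by simp) (fun a b ha hb => ?_)
    · rw [sι_comm V hv0 (comp_le_deg V x hw)]; simp
    · rw [map_add, add_mul, mul_add, ha, hb]
  | hmul a b ha hb => rw [mul_assoc, hb, ← mul_assoc, ha, mul_assoc]
  | hadd a b ha hb => rw [add_mul, mul_add, ha, hb]

/-- The canonical homomorphism `Sym V_0 → S(V)`, with values in the center. -/
def symToSuper (V : LGradedComplex K L M) :
    SymmetricAlgebra K (V.comp ⊥) →ₐ[K] Subalgebra.center K (SuperSym V) :=
  SymmetricAlgebra.lift
    ((sι V ∘ₗ (V.comp ⊥).subtype).codRestrict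
      (Subalgebra.toSubmodule (Subalgebra.center K (SuperSym V)))
      (fun v => sι_mem_center V v.2))

/-- `S(V) / 𝓘(L, V)` is an algebra over `Sym V_0`. -/
instance osAlgebraSym (V : LGradedComplex K L M) :
    Algebra (SymmetricAlgebra K (V.comp ⊥)) (OSAlgebra V) :=
  RingHom.toAlgebra'
    ((osMk V).toRingHom.comp
      ((Subalgebra.center K (SuperSym V)).val.toRingHom.comp (symToSuper V).toRingHom))
    (by
      intro c a
      obtain ⟨s, rfl⟩ := Ideal.Quotient.mkₐ_surjective K (osIdeal V) a
      have := (Subalgebra.mem_center_iff.1 (symToSuper V c).2) s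
      exact (congrArg (osMk V) this).symm)

/-- The atomic datum `(Sym V_0, (⟨∂ V_a⟩)_a)` over `Sym V_0`, where `⟨∂ V_a⟩` is the ideal of
`Sym V_0` generated by `∂ V_a ⊆ V_0`. -/
def idealDatum (V : LGradedComplex K L M) :
    AtomicDatum (SymmetricAlgebra K (V.comp ⊥)) L (SymmetricAlgebra K (V.comp ⊥)) where
  sub a _ := Ideal.span
    {s | ∃ u : V.comp ⊥, (∃ v ∈ V.comp a, V.diff v = u) ∧ s = SymmetricAlgebra.ι K (V.comp ⊥) u}

end Super

end GenOS
end

noncomputable section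

namespace GenOS

set_option linter.unusedSectionVars false

/-! ### Rank in lower intervals -/

section Rank

variable {L : Type*} [Lattice L]

/-! Fix `x` and a homotopy `d` of `V_{≤ x}`, extended from the image of `∂₁` to all of `V_0` and by
zero outside `L_{≤ x}` (`LHomotopy.exists_isHomotopyAt`). It extends to a super-derivation `D` of
`S(V)` of degree one (`exists_isSuperDer`). The weight operator `N = ∂D + D∂` is then an ordinary
derivation. On letters below `x` it is the identity in positive degree and the idempotent `∂d` on
`V_0`. So words below `x` are sums of eigenvectors whose eigenvalues are natural numbers, positive
as soon as some letter has positive degree (`mem_eigenWord`). In characteristic zero `N` can be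
inverted there, and `D N⁻¹` is a contracting homotopy.

All of this descends to the quotient because of semimodularity. Applying `∂` or `D` to a word moves
one letter to a neighbour in `L`. This changes the sum of the ranks by exactly one and the rank of
the join by at most one (`LetterStep.up_cases`, `LetterStep.down_cases`). Hence `D` preserves `I`;
from `D∂ = N - ∂D` it also preserves `I + ∂I` below `x` (`map_osIdeal`). On independent words the
two gradings agree and both operators move the join along a covering relation. The components are
independent because the projections of `S(V)` to the words below a given element preserve the ideal
(`superProj_osIdeal`, `osComp_indep`).

For the minimal complex, contractibility of each `A_{≤ x}` says that `∂` is injective on `A_x` for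
`x ≠ ⊥`, and that for `x` neither `⊥` nor an atom it maps `A_x` onto the cycles of `⨁_{y ⋖ x} A_y`.
This is the recursion that defines a minimal complex, so `A` is determined by `A_⊥` and the images
`∂ A_a` (`exists_minimalComplex_equiv`). Here `A_⊥` is `Sym V_0`, since a retraction `S(V) → Sym
V_0` kills the ideal (`superToSym_osIdeal`), and `∂ A_a` is the ideal generated by `∂ V_a`
(`osComplexSym_map_atom`). The homotopy at the top element gives exactness. -/

theorem Iic_covBy_iff {x : L} {y z : Set.Iic x} : y ⋖ z ↔ (y : L) ⋖ z :=
  ⟨fun h => ⟨h.lt, fun _ h1 h2 => h.2 (c := ⟨_, h2.le.trans z.2⟩) h1 h2⟩,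
    fun h => ⟨h.lt, fun _ h1 h2 => h.2 h1 h2⟩⟩

instance Iic_isUpperModularLattice [IsUpperModularLattice L] (x : L) :
    IsUpperModularLattice (Set.Iic x) where
  covBy_sup_of_inf_covBy h := by
    rw [Iic_covBy_iff] at h ⊢
    exact IsUpperModularLattice.covBy_sup_of_inf_covBy h

/-- The element `b ⊓ (a ⊔ c)` lies between `a` and `b`. If it is `a`, semimodularity applies to `b`
and `a ⊔ c`; if it is `b`, then `b ≤ a ⊔ c` and the joins agree. -/
theorem wcovBy_sup_right [IsUpperModularLattice L] {a b : L} (h : a ⩿ b) (c : L) : a ⊔ c ⩿ b ⊔ c := by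
  rcases h.eq_or_eq (c := b ⊓ (a ⊔ c)) (le_inf h.le le_sup_left) inf_le_left with h' | h'
  · rcases h.covBy_or_eq with h | rfl
    · have : a ⊔ c ⋖ b ⊔ (a ⊔ c) :=
        IsUpperModularLattice.covBy_sup_of_inf_covBy (h'.symm ▸ h)
      rw [← sup_assoc, sup_eq_left.2 h.le] at this
      exact this.wcovBy
    · exact WCovBy.refl _
  · have : b ⊔ c = a ⊔ c :=
      le_antisymm (sup_le (inf_eq_left.1 h') le_sup_right) (sup_le_sup_right h.le c)
    rw [this]
    exact WCovBy.refl _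

variable [OrderBot L] [IsUpperModularLattice L] [Finite L]

theorem rk_eq_zero_iff {x : L} : rk x = 0 ↔ x = ⊥ := by
  refine ⟨fun h => ?_, fun h => h ▸ rk_bot⟩
  obtain ⟨n, hn⟩ := Sat.exists (bot_le (a := x))
  rw [rk_eq hn] at h
  subst h
  cases hn
  rfl

theorem rk_eq_one_iff {x : L} : rk x = 1 ↔ ⊥ ⋖ x := by
  refine ⟨fun h => ?_, fun h => by rw [rk_covBy h, rk_bot]⟩
  obtain ⟨n, hn⟩ := Sat.exists (bot_le (a := x))
  rw [rk_eq hn] at h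
  subst h
  cases hn with
  | step h h' => cases h'; exact h

end Rank

namespace LGradedComplex

/-! ### Linear maps defined on the components -/

section Glue

variable {R L M N : Type*} [Ring R] [PartialOrder L] [AddCommGroup M] [Module R M]
  [AddCommGroup N] [Module R N] (V : LGradedComplex R L M)

theorem comp_induction {p : M → Prop} (h : ∀ x, ∀ v ∈ V.comp x, p v) (h0 : p 0)
    (hadd : ∀ a b, p a → p b → p (a + b)) (v : M) : p v :=
  Submodule.iSup_induction V.comp (motive := p) (by rw [V.span]; trivial) h h0 hadd

theorem isInternal [DecidableEq L] : DirectSum.IsInternal V.comp :=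
  (DirectSum.isInternal_submodule_iff_iSupIndep_and_iSup_eq_top V.comp).2 ⟨V.indep, V.span⟩

open Classical in
/-- The linear map with prescribed restrictions to the components. -/
def glue (f : ∀ x, V.comp x →ₗ[R] N) : M →ₗ[R] N :=
  DirectSum.toModule R L N f ∘ₗ
    (LinearEquiv.ofBijective (DirectSum.coeLinearMap V.comp) V.isInternal).symm.toLinearMap

theorem glue_apply (f : ∀ x, V.comp x →ₗ[R] N) {x : L} {v : M} (hv : v ∈ V.comp x) :
    V.glue f v = f x ⟨v, hv⟩ := by
  classical
  have h : (LinearEquiv.ofBijective (DirectSum.coeLinearMap V.comp) V.isInternal).symm v =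
      DirectSum.lof R L (fun x => V.comp x) x ⟨v, hv⟩ := by
    rw [LinearEquiv.symm_apply_eq]
    exact (DirectSum.coeLinearMap_lof V.comp x ⟨v, hv⟩).symm
  simp only [glue, LinearMap.comp_apply, LinearEquiv.coe_coe]
  have h' := DirectSum.toModule_lof R (φ := f) x ⟨v, hv⟩
  rw [← h']
  exact congrArg _ h

open Classical in
/-- The projection to the sum of the components at the elements of `s`. -/
def projOn (s : Set L) : M →ₗ[R] M :=
  V.glue fun x => if x ∈ s then (V.comp x).subtype else 0

theorem projOn_of_mem {s : Set L} {x : L} (hx : x ∈ s) {v : M} (hv : v ∈ V.comp x) :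
    V.projOn s v = v := by
  rw [projOn, V.glue_apply _ hv, if_pos hx]; rfl

theorem projOn_of_notMem {s : Set L} {x : L} (hx : x ∉ s) {v : M} (hv : v ∈ V.comp x) :
    V.projOn s v = 0 := by
  rw [projOn, V.glue_apply _ hv, if_neg hx]; rfl

theorem iSup₂_induction {P : L → Prop} {p : M → Prop} {v : M}
    (hv : v ∈ ⨆ x, ⨆ _ : P x, V.comp x) (h : ∀ x, P x → ∀ v ∈ V.comp x, p v) (h0 : p 0)
    (hadd : ∀ a b, p a → p b → p (a + b)) : p v := by
  refine Submodule.iSup_induction _ (motive := p) hv (fun x w hw => ?_) h0 hadd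
  by_cases hx : P x
  · rw [iSup_pos hx] at hw
    exact h x hx w hw
  · rw [iSup_neg hx] at hw
    rw [(Submodule.mem_bot R).1 hw]
    exact h0

theorem mem_iSup₂ {P : L → Prop} {x : L} (hx : P x) {v : M} (hv : v ∈ V.comp x) :
    v ∈ ⨆ x, ⨆ _ : P x, V.comp x :=
  (le_iSup₂_of_le x hx le_rfl : V.comp x ≤ _) hv

theorem iSup₂_mono' {P Q : L → Prop} (h : ∀ x, P x → Q x) :
    (⨆ x, ⨆ _ : P x, V.comp x) ≤ ⨆ x, ⨆ _ : Q x, V.comp x :=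
  iSup_mono fun x => iSup_mono' fun hx => ⟨h x hx, le_rfl⟩

theorem lower_map_iSup (x : L) (Q : Set.Iic x → Prop) :
    (⨆ y, ⨆ _ : Q y, (V.lower x).comp y).map (⨆ y : Set.Iic x, V.comp y).subtype =
      ⨆ z, ⨆ _ : (∃ h : z ≤ x, Q ⟨z, h⟩), V.comp z := by
  simp only [Submodule.map_iSup]
  have e : ∀ y : Set.Iic x, ((V.lower x).comp y).map (⨆ y : Set.Iic x, V.comp y).subtype =
      V.comp y := fun y => by
    change Submodule.map _ ((V.comp y).comap _) = _
    rw [Submodule.map_comap_subtype, inf_eq_right]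
    exact le_iSup (fun y : Set.Iic x => V.comp y) y
  simp only [e]
  refine le_antisymm (iSup₂_le fun y hy => ?_) (iSup₂_le fun z hz => ?_)
  · exact le_iSup₂_of_le y.1 ⟨y.2, hy⟩ le_rfl
  · exact le_iSup₂_of_le ⟨z, hz.1⟩ hz.2 le_rfl

/-- The complex `V.lower x` lives on subtypes of both the lattice and the module; this moves
membership questions back to `L` and `M`. -/
theorem mem_lower_iSup {x : L} {Q : Set.Iic x → Prop} {v : ↥(⨆ y : Set.Iic x, V.comp y)} :
    v ∈ (⨆ y, ⨆ _ : Q y, (V.lower x).comp y) ↔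
      (v : M) ∈ ⨆ z, ⨆ _ : (∃ h : z ≤ x, Q ⟨z, h⟩), V.comp z := by
  rw [← V.lower_map_iSup x Q]
  constructor
  · exact fun h => Submodule.mem_map_of_mem h
  · rintro ⟨w, hw, e⟩
    rwa [← Subtype.ext e]

end Glue

/-! ### Contractibility in terms of endomorphisms of the total module -/

section Contract

variable {K L M : Type*} [Field K] [Lattice L] [OrderBot L] [IsUpperModularLattice L] [Finite L]
  [AddCommGroup M] [Module K M] (V : LGradedComplex K L M)

/-- An endomorphism of the total module which induces an `L`-homotopy of `V_{≤ x}`. -/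
structure IsHomotopyAt (x : L) (d : M →ₗ[K] M) : Prop where
  mem : ∀ y ≤ x, y ≠ ⊥ → ∀ v ∈ V.comp y, d v ∈ ⨆ z, ⨆ _ : y ⋖ z ∧ z ≤ x, V.comp z
  homotopy : ∀ y ≤ x, y ≠ ⊥ → ∀ v ∈ V.comp y, d (V.diff v) + V.diff (d v) = v

variable {V}

/-- The restriction of `d` to the image of `∂₁` serves as `d₀`. In the other degrees `d` is first
cut off at `⊥` and outside `L_{≤ x}`, where its values are arbitrary, so that it preserves the total
module of `V_{≤ x}`. -/
theorem IsHomotopyAt.nonempty {x : L} {d : M →ₗ[K] M} (h : V.IsHomotopyAt x d) :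
    Nonempty (V.lower x).LHomotopy := by
  classical
  let Mx := ⨆ y : Set.Iic x, V.comp y
  have hMx : ∀ {y} (_ : y ≤ x) {v}, v ∈ V.comp y → v ∈ Mx := fun {y} hy {v} hv =>
    (le_iSup (fun y : Set.Iic x => V.comp y) ⟨y, hy⟩) hv
  have hle : ∀ {P : L → Prop}, (∀ z, P z → z ≤ x) → (⨆ z, ⨆ _ : P z, V.comp z) ≤ Mx :=
    fun hP => iSup₂_le fun z hz v hv => hMx (hP z hz) hv
  -- the values on degree at least one
  let d' : M →ₗ[K] M := d ∘ₗ V.projOn {y | y ≤ x ∧ y ≠ ⊥}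
  have hd' : ∀ y ≤ x, y ≠ ⊥ → ∀ v ∈ V.comp y, d' v = d v := fun y hy hy0 v hv => by
    simp only [d', LinearMap.comp_apply]
    rw [V.projOn_of_mem (s := {y | y ≤ x ∧ y ≠ ⊥}) ⟨hy, hy0⟩ hv]
  have hd'Mx : ∀ v, d' v ∈ Mx := by
    refine V.comp_induction (fun y v hv => ?_) (by simp) (fun a b ha hb => ?_)
    · by_cases hy : y ≤ x ∧ y ≠ ⊥
      · rw [hd' y hy.1 hy.2 v hv]
        exact hle (fun z hz => hz.2) (h.mem y hy.1 hy.2 v hv)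
      · simp only [d', LinearMap.comp_apply]
        rw [V.projOn_of_notMem (s := {y | y ≤ x ∧ y ≠ ⊥}) hy hv]
        simp
    · rw [map_add]; exact add_mem ha hb
  -- Nothing is assumed about `d` on `V_⊥`, but the equation `d ∂ v = v - ∂ d v` at atoms forces the
  -- values on the image of `∂₁` into degree one.
  have hdeg1 : ∀ v ∈ (V.lower x).deg 1,
      d (V.diff v) ∈ (⨆ z, ⨆ _ : (∃ h : z ≤ x, rk (⟨z, h⟩ : Set.Iic x) = 1), V.comp z) := by
    intro v hv
    rw [deg, mem_lower_iSup] at hv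
    refine V.iSup₂_induction (p := fun v => d (V.diff v) ∈ _) hv ?_ (by simp)
      (fun a b ha hb => by rw [map_add, map_add]; exact add_mem ha hb)
    rintro y ⟨hy, hy1⟩ v hv
    have hb : ⊥ ⋖ y := Iic_covBy_iff.1 (rk_eq_one_iff.1 hy1)
    have e := h.homotopy y hy hb.ne' v hv
    rw [← eq_sub_iff_add_eq] at e
    rw [e]
    refine sub_mem (V.mem_iSup₂ (P := fun z => ∃ h : z ≤ x, rk (⟨z, h⟩ : Set.Iic x) = 1)
      ⟨hy, hy1⟩ hv) ?_
    refine V.iSup₂_induction (p := fun v => V.diff v ∈ _) (h.mem y hy hb.ne' v hv) ?_ (by simp)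
      (fun a b ha hb => by rw [map_add]; exact add_mem ha hb)
    rintro z ⟨hyz, hz⟩ w hw
    refine V.iSup₂_mono' ?_ (V.diff_mem z w hw)
    intro t ht
    have htx : t ≤ x := ht.le.trans hz
    refine ⟨htx, rk_eq_one_iff.2 (Iic_covBy_iff.2 ?_)⟩
    change ⊥ ⋖ t
    rw [← rk_eq_one_iff] at hb ⊢
    have := rk_covBy ht
    have := rk_covBy hyz
    omega
  have hd1 : ∀ u ∈ ((V.lower x).deg 1).map (V.lower x).diff,
      d (u : M) ∈ (⨆ z, ⨆ _ : (∃ h : z ≤ x, rk (⟨z, h⟩ : Set.Iic x) = 1), V.comp z) := by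
    rintro _ ⟨v, hv, rfl⟩
    exact hdeg1 v hv
  refine ⟨
    { d₀ := LinearMap.codRestrict _ (LinearMap.codRestrict Mx
          (d ∘ₗ Mx.subtype ∘ₗ (((V.lower x).deg 1).map (V.lower x).diff).subtype)
          (fun u => hle (fun z hz => hz.1) (hd1 u.1 u.2)))
          (fun u => V.mem_lower_iSup.2 (hd1 u.1 u.2))
      d := LinearMap.codRestrict Mx (d' ∘ₗ Mx.subtype) (fun v => hd'Mx v)
      d_mem := ?_
      homotopy_one := ?_
      homotopy := ?_ }⟩
  · intro y hy v hv
    rw [mem_lower_iSup]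
    have hy0 : (y : L) ≠ ⊥ := fun h => hy (Subtype.ext h)
    change d' v ∈ _
    rw [hd' y y.2 hy0 v hv]
    exact V.iSup₂_mono' (fun z hz => ⟨hz.2, Iic_covBy_iff.2 hz.1⟩) (h.mem y y.2 hy0 v hv)
  · intro v hv
    apply Subtype.ext
    change d (V.diff v) + V.diff (d' v) = v
    rw [deg, mem_lower_iSup] at hv
    refine V.iSup₂_induction (p := fun v => d (V.diff v) + V.diff (d' v) = v) hv ?_ (by simp)
      (fun a b ha hb => by simp only [map_add]; rw [add_add_add_comm, ha, hb])
    rintro y ⟨hy, hy1⟩ v hv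
    have hb : ⊥ ⋖ y := Iic_covBy_iff.1 (rk_eq_one_iff.1 hy1)
    rw [hd' y hy hb.ne' v hv]
    exact h.homotopy y hy hb.ne' v hv
  · intro i hi v hv
    apply Subtype.ext
    change d' (V.diff v) + V.diff (d' v) = v
    rw [deg, mem_lower_iSup] at hv
    refine V.iSup₂_induction (p := fun v => d' (V.diff v) + V.diff (d' v) = v) hv ?_ (by simp)
      (fun a b ha hb => by simp only [map_add]; rw [add_add_add_comm, ha, hb])
    rintro y ⟨hy, hyi⟩ v hv
    have hy0 : y ≠ ⊥ := by
      rintro rfl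
      have := rk_eq_zero_iff.2 (rfl : (⟨⊥, hy⟩ : Set.Iic x) = ⊥)
      omega
    rw [hd' y hy hy0 v hv]
    have : d' (V.diff v) = d (V.diff v) := by
      refine V.iSup₂_induction (p := fun v => d' v = d v) (V.diff_mem y v hv) ?_ (by simp)
        (fun a b ha hb => by simp only [map_add]; rw [ha, hb])
      intro z hz w hw
      refine hd' z (hz.le.trans hy) ?_ w hw
      rintro rfl
      have := rk_eq_one_iff.2 (Iic_covBy_iff.2 hz : (⊥ : Set.Iic x) ⋖ ⟨y, hy⟩)
      omega
    rw [this]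
    exact h.homotopy y hy hy0 v hv

/-- A derivation of `S(V)` needs values on every letter, so the homotopy must become an endomorphism
of all of `M`. The last two clauses keep the grading condition valid at `⊥` and outside `L_{≤ x}`.
-/
theorem LHomotopy.exists_isHomotopyAt {x : L} (h : (V.lower x).LHomotopy) :
    ∃ d : M →ₗ[K] M, V.IsHomotopyAt x d ∧
      (∀ v ∈ V.comp ⊥, d v ∈ ⨆ z, ⨆ _ : ⊥ ⋖ z ∧ z ≤ x, V.comp z) ∧
      ∀ y, ¬ y ≤ x → ∀ v ∈ V.comp y, d v = 0 := by
  classical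
  let Mx := ⨆ y : Set.Iic x, V.comp y
  have hMx : ∀ {y} (_ : y ≤ x) {v}, v ∈ V.comp y → v ∈ Mx := fun {y} hy {v} hv =>
    (le_iSup (fun y : Set.Iic x => V.comp y) ⟨y, hy⟩) hv
  -- Over a field `d₀` extends from the subspace `im ∂₁`, with values still in degree one.
  obtain ⟨g, hg⟩ := LinearMap.exists_extend h.d₀
  let emb : ∀ y : L, y ≤ x → (V.comp y →ₗ[K] Mx) := fun y hy =>
    LinearMap.codRestrict Mx (V.comp y).subtype (fun v => hMx hy v.2)
  let d : M →ₗ[K] M := V.glue fun y =>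
    if hy : y ≤ x then
      if y = ⊥ then Mx.subtype ∘ₗ ((V.lower x).deg 1).subtype ∘ₗ g ∘ₗ emb y hy
      else Mx.subtype ∘ₗ h.d ∘ₗ emb y hy
    else 0
  have d_bot : ∀ v (hv : v ∈ V.comp ⊥), d v = g ⟨v, hMx bot_le hv⟩ := fun v hv => by
    simp only [d]
    rw [V.glue_apply _ hv, dif_pos bot_le, if_pos rfl]; rfl
  have d_ne : ∀ y (hy : y ≤ x), y ≠ ⊥ → ∀ v (hv : v ∈ V.comp y), d v = h.d ⟨v, hMx hy hv⟩ :=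
    fun y hy hy0 v hv => by
      simp only [d]
      rw [V.glue_apply _ hv, dif_pos hy, if_neg hy0]; rfl
  refine ⟨d, ⟨?_, ?_⟩, ?_, ?_⟩
  · intro y hy hy0 v hv
    rw [d_ne y hy hy0 v hv]
    have := h.d_mem ⟨y, hy⟩ (fun e => hy0 (congrArg Subtype.val e)) ⟨v, hMx hy hv⟩ hv
    rw [mem_lower_iSup] at this
    exact V.iSup₂_mono' (fun z ⟨hz, hz'⟩ => ⟨Iic_covBy_iff.1 hz', hz⟩) this
  · intro y hy hy0 v hv
    rw [d_ne y hy hy0 v hv]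
    have hdeg : (⟨v, hMx hy hv⟩ : Mx) ∈ (V.lower x).deg (rk (⟨y, hy⟩ : Set.Iic x)) :=
      (V.lower x).mem_iSup₂ (P := fun z => rk z = rk (⟨y, hy⟩ : Set.Iic x)) rfl hv
    have hr0 : rk (⟨y, hy⟩ : Set.Iic x) ≠ 0 := fun e =>
      hy0 (congrArg Subtype.val (rk_eq_zero_iff.1 e))
    -- At an atom `∂ v` lies in `V_⊥`, where `d` is the extension of `d₀`; in higher rank `∂ v` has
    -- no component at `⊥`, and `d` agrees with `h.d` on it.
    by_cases hr : rk (⟨y, hy⟩ : Set.Iic x) = 1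
    · rw [hr] at hdeg
      have := congrArg Subtype.val (h.homotopy_one _ hdeg)
      have hb : V.diff v ∈ V.comp ⊥ := by
        refine SetLike.le_def.1 (iSup₂_le fun z hz => ?_) (V.diff_mem y v hv)
        have hb : ⊥ ⋖ y := Iic_covBy_iff.1 (rk_eq_one_iff.1 hr)
        have h1 := rk_covBy hz
        rw [rk_eq_one_iff.2 hb] at h1
        rw [rk_eq_zero_iff.1 (by omega : rk z = 0)]
      rw [d_bot _ hb]
      convert this using 1
      change _ = (_ : M) + V.diff _
      congr 2
      exact congrArg Subtype.val (LinearMap.congr_fun hg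
        ⟨(V.lower x).diff ⟨v, hMx hy hv⟩, Submodule.mem_map_of_mem hdeg⟩)
    · have := congrArg Subtype.val (h.homotopy _ (by omega) _ hdeg)
      convert this using 1
      change _ = ((h.d ((V.lower x).diff ⟨v, hMx hy hv⟩) : Mx) : M) + V.diff _
      congr 1
      have key : ∀ w ∈ (⨆ z, ⨆ _ : z ⋖ y, V.comp z), ∃ hw : w ∈ Mx, d w = h.d ⟨w, hw⟩ := by
        intro w hw
        refine V.iSup₂_induction (p := fun w => ∃ hw : w ∈ Mx, d w = h.d ⟨w, hw⟩) hw ?_ ?_ ?_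
        · intro z hz w hw
          refine ⟨hMx (hz.le.trans hy) hw, d_ne z (hz.le.trans hy) ?_ w hw⟩
          rintro rfl
          exact hr (rk_eq_one_iff.2 (Iic_covBy_iff.2 hz : (⊥ : Set.Iic x) ⋖ ⟨y, hy⟩))
        · refine ⟨zero_mem _, ?_⟩
          rw [map_zero]
          exact (congrArg Subtype.val (map_zero h.d)).symm
        · rintro a b ⟨ha, ha'⟩ ⟨hb, hb'⟩
          refine ⟨add_mem ha hb, ?_⟩
          rw [map_add, ha', hb']
          exact (congrArg Subtype.val (map_add h.d ⟨a, ha⟩ ⟨b, hb⟩)).symm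
      obtain ⟨_, e⟩ := key _ (V.diff_mem y v hv)
      exact e
  · intro v hv
    rw [d_bot v hv]
    have := V.mem_lower_iSup.1 (g ⟨v, hMx bot_le hv⟩).2
    refine V.iSup₂_mono' ?_ this
    rintro z ⟨hz, hz'⟩
    exact ⟨Iic_covBy_iff.1 (rk_eq_one_iff.1 hz'), hz⟩
  · intro y hy v hv
    simp only [d]
    rw [V.glue_apply _ hv, dif_neg hy]; rfl

end Contract

end LGradedComplex

/-! ### Characterization of the minimal complex -/

namespace LGradedComplex

section

variable {R L E : Type*} [Ring R] [PartialOrder L] [AddCommGroup E] [Module R E]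
  (A : LGradedComplex R L E)

theorem diff_comp_bot [OrderBot L] {v : E} (hv : v ∈ A.comp ⊥) : A.diff v = 0 := by
  rw [← Submodule.mem_bot R]
  exact SetLike.le_def.1 (iSup₂_le fun y hy => absurd hy.lt not_lt_bot) (A.diff_mem ⊥ v hv)

theorem projOn_singleton_mem (x : L) (v : E) : A.projOn {x} v ∈ A.comp x := by
  refine A.comp_induction (p := fun v => A.projOn {x} v ∈ A.comp x) (fun y v hv => ?_) (by simp)
    (fun a b ha hb => by rw [map_add]; exact add_mem ha hb) v
  by_cases h : y = x
  · subst h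
    rwa [A.projOn_of_mem (s := {y}) rfl hv]
  · rw [A.projOn_of_notMem (s := {x}) h hv]
    exact zero_mem _

theorem sum_projOn_singleton [Fintype L] (v : E) : ∑ x, A.projOn {x} v = v := by
  classical
  refine A.comp_induction (p := fun v => ∑ x, A.projOn {x} v = v) (fun y v hv => ?_) (by simp)
    (fun a b ha hb => by simp only [map_add, Finset.sum_add_distrib, ha, hb]) v
  rw [Finset.sum_eq_single y]
  · exact A.projOn_of_mem (s := {y}) rfl hv
  · intro x _ h
    exact A.projOn_of_notMem (s := {x}) (fun e => h (Set.mem_singleton_iff.1 e).symm) hv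
  · simp

theorem projOn_eq_zero {s : Set L} {P : L → Prop} (h : ∀ x, P x → x ∉ s) {v : E}
    (hv : v ∈ ⨆ x, ⨆ _ : P x, A.comp x) : A.projOn s v = 0 :=
  A.iSup₂_induction (p := fun v => A.projOn s v = 0) hv
    (fun x hx _ hw => A.projOn_of_notMem (h x hx) hw) (by simp)
    (fun a b ha hb => by rw [map_add, ha, hb, add_zero])

end

section

variable {R L E U : Type*} [Ring R] [Fintype L] [Lattice L] [OrderBot L] [AddCommGroup E]
  [Module R E] [AddCommGroup U] [Module R U] (A : LGradedComplex R L E) (κ : E →ₗ[R] U)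

/-- The value at a word of the embedding of `A` into the functions on words. -/
def wordMap : List L → (E →ₗ[R] U)
  | [] => κ
  | x :: c => wordMap c ∘ₗ A.diff ∘ₗ A.projOn {x}

/-- The map to the functions on words which records iterated components of differentials. -/
def toWords : E →ₗ[R] (List L → U) := LinearMap.pi (A.wordMap κ)

/-- Here `κ` is to be thought of as the projection to `A_⊥ ≅ U`. Away from `⊥` the embedding then
follows the recursion of `minimalComp`: differentiate, embed, mark by `x`. -/
theorem toWords_eq_tag (hκ : ∀ x ≠ ⊥, ∀ v ∈ A.comp x, κ v = 0) {x : L} (hx : x ≠ ⊥) {v : E}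
    (hv : v ∈ A.comp x) : A.toWords κ v = tag R x (A.toWords κ (A.diff v)) := by
  classical
  funext l
  rcases l with _ | ⟨y, c⟩
  · exact hκ x hx v hv
  · change A.wordMap κ c (A.diff (A.projOn {y} v)) =
      if y = x then A.wordMap κ c (A.diff v) else 0
    by_cases h : y = x
    · subst h
      rw [A.projOn_of_mem (s := {y}) rfl hv, if_pos rfl]
    · rw [A.projOn_of_notMem (s := {y}) (fun e => h (Set.mem_singleton_iff.1 e).symm) hv,
        if_neg h, map_zero, map_zero]

theorem toWords_eq_base {v : E} (hv : v ∈ A.comp ⊥) : A.toWords κ v = base R L U (κ v) := by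
  classical
  funext l
  rcases l with _ | ⟨y, c⟩
  · simp [base, toWords, wordMap]
  · have : A.diff (A.projOn {y} v) = 0 := by
      by_cases h : y = ⊥
      · subst h
        exact A.diff_comp_bot (A.projOn_singleton_mem ⊥ v)
      · rw [A.projOn_of_notMem (s := {y}) (fun e => h (Set.mem_singleton_iff.1 e).symm) hv,
          map_zero]
    change A.wordMap κ c (A.diff (A.projOn {y} v)) = _
    rw [this, map_zero]
    simp [base]

theorem untag_toWords (hκ : ∀ x ≠ ⊥, ∀ v ∈ A.comp x, κ v = 0) (v : E) :
    untag R L U (A.toWords κ v) = A.toWords κ (A.diff v) := by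
  refine A.comp_induction
    (p := fun v => untag R L U (A.toWords κ v) = A.toWords κ (A.diff v)) (fun x v hv => ?_)
    (by simp) (fun a b ha hb => by simp only [map_add, ha, hb]) v
  by_cases hx : x = ⊥
  · subst hx
    rw [A.toWords_eq_base κ hv, untag_base, A.diff_comp_bot hv, map_zero]
  · rw [A.toWords_eq_tag κ hκ hx hv, untag_tag]

/-- The kernel is graded: words with first letter `x` see only the component at `x`, and the empty
word sees only the one at `⊥`. -/
theorem toWords_projOn_eq_zero (hκ : ∀ x ≠ ⊥, ∀ v ∈ A.comp x, κ v = 0) {v : E}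
    (hv : A.toWords κ v = 0) (x : L) : A.toWords κ (A.projOn {x} v) = 0 := by
  by_cases hx : x = ⊥
  · subst hx
    have h1 : κ v = κ (A.projOn {⊥} v) := by
      refine A.comp_induction (p := fun v => κ v = κ (A.projOn {⊥} v)) (fun x v hv => ?_)
        (by simp) (fun a b ha hb => by simp only [map_add, ha, hb]) v
      by_cases hx : x = ⊥
      · rw [A.projOn_of_mem (s := {⊥}) hx hv]
      · rw [A.projOn_of_notMem (s := {⊥}) hx hv, hκ x hx v hv, map_zero]
    have h2 : κ v = 0 := congrFun hv []
    rw [A.toWords_eq_base κ (A.projOn_singleton_mem ⊥ v), ← h1, h2, map_zero]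
  · rw [A.toWords_eq_tag κ hκ hx (A.projOn_singleton_mem x v)]
    have : A.toWords κ (A.diff (A.projOn {x} v)) = 0 := by
      funext c
      exact congrFun hv (x :: c)
    rw [this, map_zero]

/-- Induction on the component. If `v ∈ A_x` is killed, so is `∂ v`, hence so are its components at
`y < x`. These vanish by induction, and `∂` is injective on `A_x`. -/
theorem toWords_injective (hκ : ∀ x ≠ ⊥, ∀ v ∈ A.comp x, κ v = 0)
    (hκ0 : ∀ v ∈ A.comp ⊥, κ v = 0 → v = 0)
    (hinj : ∀ x ≠ ⊥, ∀ v ∈ A.comp x, A.diff v = 0 → v = 0) :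
    Function.Injective (A.toWords κ) := by
  have key : ∀ x, ∀ v ∈ A.comp x, A.toWords κ v = 0 → v = 0 := by
    intro x
    induction x using WellFoundedLT.induction with
    | ind x ih =>
      intro v hv h
      by_cases hx : x = ⊥
      · subst hx
        exact hκ0 v hv (congrFun h [])
      · refine hinj x hx v hv ?_
        have h0 : A.toWords κ (A.diff v) = 0 := by
          rw [← A.untag_toWords κ hκ, h, map_zero]
        rw [← A.sum_projOn_singleton (A.diff v)]
        refine Finset.sum_eq_zero fun y _ => ?_
        by_cases hy : y < x
        · exact ih y hy _ (A.projOn_singleton_mem y _) (A.toWords_projOn_eq_zero κ hκ h0 y)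
        · refine A.projOn_eq_zero (P := fun y => y ⋖ x) ?_ (A.diff_mem x v hv)
          rintro z hz rfl
          exact hy hz.lt
  rw [injective_iff_map_eq_zero]
  intro v hv
  rw [← A.sum_projOn_singleton v]
  exact Finset.sum_eq_zero fun y _ =>
    key y _ (A.projOn_singleton_mem y _) (A.toWords_projOn_eq_zero κ hκ hv y)

/-- Both sides satisfy the same recursion. For `x` neither `⊥` nor an atom, `∂ A_x` consists of all
cycles in `⨁_{y ⋖ x} A_y`, and the injective map `toWords`, which turns `∂` into `untag`, carries
these onto the kernel used in `minimalComp`. -/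
theorem comp_map_toWords (D : AtomicDatum R L U) (hκ : ∀ x ≠ ⊥, ∀ v ∈ A.comp x, κ v = 0)
    (hκ0 : ∀ v ∈ A.comp ⊥, κ v = 0 → v = 0) (hκs : (A.comp ⊥).map κ = ⊤)
    (hinj : ∀ x ≠ ⊥, ∀ v ∈ A.comp x, A.diff v = 0 → v = 0)
    (hex : ∀ x ≠ ⊥, ¬ IsAtom x → ∀ w ∈ ⨆ y, ⨆ _ : y ⋖ x, A.comp y, A.diff w = 0 →
      ∃ v ∈ A.comp x, A.diff v = w)
    (hatom : ∀ a (ha : IsAtom a), ((A.comp a).map A.diff).map κ = D.sub a ha) (x : L) :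
    (A.comp x).map (A.toWords κ) = minimalComp D x := by
  have hθ := A.toWords_injective κ hκ hκ0 hinj
  have htag : ∀ x ≠ ⊥, (A.comp x).map (A.toWords κ) =
      (((A.comp x).map A.diff).map (A.toWords κ)).map (tag R x) := by
    intro x hx
    ext f
    simp only [Submodule.mem_map, exists_exists_and_eq_and]
    exact exists_congr fun v => and_congr_right fun hv => by rw [A.toWords_eq_tag κ hκ hx hv]
  have hbase : ∀ p ≤ A.comp ⊥, p.map (A.toWords κ) = (p.map κ).map (base R L U) := by
    intro p hp
    ext f
    simp only [Submodule.mem_map, exists_exists_and_eq_and]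
    exact exists_congr fun v => and_congr_right fun hv => by rw [A.toWords_eq_base κ (hp hv)]
  induction x using WellFoundedLT.induction with
  | ind x ih =>
    by_cases hx : x = ⊥
    · subst hx
      rw [minimalComp_bot, hbase _ le_rfl, hκs, Submodule.map_top]
    by_cases ha : IsAtom x
    · rw [minimalComp_atom D ha, htag x hx, hbase, hatom x ha]
      rintro _ ⟨v, hv, rfl⟩
      refine SetLike.le_def.1 (iSup₂_le fun y hy => ?_) (A.diff_mem x v hv)
      rw [ha.lt_iff.1 hy.lt]
    · rw [minimalComp_of_not_atom D hx ha, htag x hx]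
      congr 1
      have e : (⨆ y : {y : L // y ⋖ x}, minimalComp D y.1) =
          (⨆ y, ⨆ _ : y ⋖ x, A.comp y).map (A.toWords κ) := by
        rw [iSup_subtype', Submodule.map_iSup]
        exact iSup_congr fun y => (ih y.1 y.2.lt).symm
      rw [e]
      ext f
      constructor
      · rintro ⟨_, ⟨v, hv, rfl⟩, rfl⟩
        refine ⟨?_, Submodule.mem_map_of_mem (A.diff_mem x v hv)⟩
        change untag R L U _ = 0
        rw [A.untag_toWords κ hκ, A.diff_diff, map_zero]
      · rintro ⟨h1, w, hw, rfl⟩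
        refine Submodule.mem_map_of_mem ?_
        refine hex x hx ha w hw (hθ ?_)
        rw [← A.untag_toWords κ hκ, map_zero]
        exact h1

/-- A complex with the exactness properties of a minimal complex is a minimal complex. -/
theorem exists_minimalComplex_equiv (D : AtomicDatum R L U) (ψ : U →ₗ[R] E)
    (hψ : Function.Injective ψ) (hψr : LinearMap.range ψ = A.comp ⊥)
    (hinj : ∀ x ≠ ⊥, ∀ v ∈ A.comp x, A.diff v = 0 → v = 0)
    (hex : ∀ x ≠ ⊥, ¬ IsAtom x → ∀ w ∈ ⨆ y, ⨆ _ : y ⋖ x, A.comp y, A.diff w = 0 →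
      ∃ v ∈ A.comp x, A.diff v = w)
    (hatom : ∀ a (ha : IsAtom a), (A.comp a).map A.diff = (D.sub a ha).map ψ) :
    ∃ φ : ↥(⨆ x, minimalComp D x) ≃ₗ[R] E,
      (∀ s, φ (minimalBase D s) = ψ s) ∧
      (∀ v, φ ((minimalComplex D).diff v) = A.diff (φ v)) ∧
      (∀ x v, v ∈ (minimalComplex D).comp x ↔ φ v ∈ A.comp x) := by
  classical
  let e := LinearEquiv.ofInjective ψ hψ
  -- The inverse of `ψ` on `A_⊥`, extended by zero to the other components.
  let κ : E →ₗ[R] U := A.glue fun x =>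
    if h : x = ⊥ then e.symm.toLinearMap ∘ₗ
      Submodule.inclusion (h ▸ hψr.ge : A.comp x ≤ LinearMap.range ψ) else 0
  have hκ : ∀ x ≠ ⊥, ∀ v ∈ A.comp x, κ v = 0 := fun x hx v hv => by
    simp only [κ]
    rw [A.glue_apply _ hv, dif_neg hx]; rfl
  have hκψ : ∀ u, κ (ψ u) = u := fun u => by
    have hu : ψ u ∈ A.comp ⊥ := by rw [← hψr]; exact ⟨u, rfl⟩
    simp only [κ]
    rw [A.glue_apply _ hu, dif_pos rfl]
    exact e.symm_apply_apply u
  have hκ0 : ∀ v ∈ A.comp ⊥, κ v = 0 → v = 0 := by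
    intro v hv h
    rw [← hψr] at hv
    obtain ⟨u, rfl⟩ := hv
    rw [hκψ] at h
    rw [h, map_zero]
  have hκψ' : ∀ p : Submodule R U, (p.map ψ).map κ = p := fun p => by
    rw [← Submodule.map_comp, show κ ∘ₗ ψ = LinearMap.id from LinearMap.ext hκψ, Submodule.map_id]
  have hκs : (A.comp ⊥).map κ = ⊤ := by
    rw [← hψr, ← Submodule.map_top, hκψ']
  have hmap := A.comp_map_toWords κ D hκ hκ0 hκs hinj hex
    (fun a ha => by rw [hatom a ha, hκψ'])
  have hθ := A.toWords_injective κ hκ hκ0 hinj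
  have hrange : LinearMap.range (A.toWords κ) = ⨆ x, minimalComp D x := by
    rw [← Submodule.map_top, ← A.span, Submodule.map_iSup]
    exact iSup_congr hmap
  let Θ : E ≃ₗ[R] ↥(⨆ x, minimalComp D x) :=
    (LinearEquiv.ofInjective _ hθ).trans (LinearEquiv.ofEq _ _ hrange)
  have hΘ : ∀ v, (Θ v : List L → U) = A.toWords κ v := fun v => rfl
  refine ⟨Θ.symm, fun s => ?_, fun v => ?_, fun x v => ?_⟩
  · rw [LinearEquiv.symm_apply_eq]
    apply Subtype.ext
    have hu : ψ s ∈ A.comp ⊥ := by rw [← hψr]; exact ⟨s, rfl⟩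
    rw [hΘ, A.toWords_eq_base κ hu, hκψ]
    rfl
  · obtain ⟨w, rfl⟩ := Θ.surjective v
    rw [LinearEquiv.symm_apply_eq, LinearEquiv.symm_apply_apply]
    apply Subtype.ext
    rw [hΘ, ← A.untag_toWords κ hκ]
    rfl
  · obtain ⟨w, rfl⟩ := Θ.surjective v
    rw [LinearEquiv.symm_apply_apply]
    change A.toWords κ w ∈ minimalComp D x ↔ _
    rw [← hmap x]
    constructor
    · rintro ⟨w', hw', h⟩
      rwa [← hθ h]
    · exact fun h => Submodule.mem_map_of_mem h

end

/-! ### Transport of exactness along isomorphisms of graded complexes -/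

section

variable {R L E E' : Type*} [Ring R] [PartialOrder L] [AddCommGroup E] [Module R E]
  [AddCommGroup E'] [Module R E'] {A : LGradedComplex R L E} {B : LGradedComplex R L E'}

theorem Acyclic.of_equiv (hA : A.Acyclic) (φ : E' ≃ₗ[R] E)
    (hd : ∀ v, φ (B.diff v) = A.diff (φ v)) (hc : ∀ x v, v ∈ B.comp x ↔ φ v ∈ A.comp x) :
    B.Acyclic := by
  have hdeg : ∀ i v, v ∈ B.deg i ↔ φ v ∈ A.deg i := by
    intro i v
    have e : A.deg i = (B.deg i).map φ.toLinearMap := by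
      simp only [deg, Submodule.map_iSup]
      refine iSup_congr fun x => iSup_congr fun _ => ?_
      ext w
      constructor
      · intro hw
        exact ⟨φ.symm w, (hc x _).2 (by simpa using hw), by simp⟩
      · rintro ⟨v, hv, rfl⟩
        exact (hc x v).1 hv
    rw [e]
    constructor
    · exact fun h => Submodule.mem_map_of_mem h
    · rintro ⟨w, hw, h⟩
      rwa [← φ.injective h]
  intro i hi v hv h0
  obtain ⟨w, hw, h⟩ := hA i hi (φ v) ((hdeg i v).1 hv) (by rw [← hd, h0, map_zero])
  refine ⟨φ.symm w, (hdeg _ _).2 (by simpa using hw), φ.injective ?_⟩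
  rw [hd, LinearEquiv.apply_symm_apply, h]

end

end LGradedComplex

/-! ### Independence of families with projections -/

section Indep

/-- Additive maps suffice, so the `K`-linear projections can later serve for submodules over `Sym
V_0`. -/
theorem iSupIndep_of_proj {R L E : Type*} [Ring R] [AddCommGroup E] [Module R E]
    {p : L → Submodule R E} (r : L → E →+ E) (h1 : ∀ x, ∀ v ∈ p x, r x v = v)
    (h2 : ∀ x y, y ≠ x → ∀ v ∈ p y, r x v = 0) : iSupIndep p := by
  rw [iSupIndep_def]
  intro x
  rw [Submodule.disjoint_def]
  intro v hv hv'
  rw [← h1 x v hv]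
  refine Submodule.iSup_induction _ (motive := fun w => r x w = 0) hv' (fun y w hw => ?_)
    (map_zero _) (fun a b ha hb => by rw [map_add, ha, hb, add_zero])
  by_cases hy : y ≠ x
  · rw [iSup_pos hy] at hw
    exact h2 x y hy w hw
  · rw [iSup_neg hy] at hw
    rw [(Submodule.mem_bot R).1 hw, map_zero]

/-- Möbius inversion: `q x` acts as the sum of the projections `r y` to single components over `y ≤
x`, so `r x = q x - ∑_{y < x} r y` defines them recursively. -/
theorem iSupIndep_of_lower_proj {R L E : Type*} [Ring R] [PartialOrder L] [Finite L]
    [AddCommGroup E] [Module R E] {p : L → Submodule R E} (q : L → E →+ E)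
    (h1 : ∀ x y, y ≤ x → ∀ v ∈ p y, q x v = v)
    (h2 : ∀ x y, ¬ y ≤ x → ∀ v ∈ p y, q x v = 0) : iSupIndep p := by
  classical
  have := Fintype.ofFinite L
  have key : ∀ x, ∃ r : E →+ E, ∀ z, ∀ v ∈ p z, r v = if z = x then v else 0 := by
    intro x
    induction x using WellFoundedLT.induction with
    | ind x ih =>
      choose r hr using ih
      refine ⟨q x - ∑ y : {y // y < x}, r y.1 y.2, fun z v hv => ?_⟩
      rw [AddMonoidHom.sub_apply, AddMonoidHom.finsetSum_apply,
        Finset.sum_congr rfl (fun y _ => hr y.1 y.2 z v hv)]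
      by_cases hz : z < x
      · rw [h1 x z hz.le v hv, Finset.sum_eq_single (⟨z, hz⟩ : {y // y < x}), if_pos rfl,
          if_neg hz.ne, sub_self]
        · intro y _ hy
          exact if_neg fun e => hy (Subtype.ext e.symm)
        · simp
      · rw [Finset.sum_eq_zero (fun y _ => if_neg fun e => hz (by rw [e]; exact y.2)), sub_zero]
        by_cases e : z = x
        · rw [if_pos e, h1 x z e.le v hv]
        · rw [if_neg e, h2 x z (fun h => hz (lt_of_le_of_ne h e)) v hv]
  choose r hr using key
  exact iSupIndep_of_proj r (fun x v hv => by rw [hr x x v hv, if_pos rfl])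
    (fun x y h v hv => by rw [hr x y v hv, if_neg h])

end Indep

/-! ### Joins and steps -/

section Step

variable {L : Type*}

/-- `l'` arises from `l` by replacing one letter `y` with some `z` such that `T y z`. -/
inductive LetterStep (T : L → L → Prop) : List L → List L → Prop
  | head {y z : L} {l : List L} (h : T y z) : LetterStep T (y :: l) (z :: l)
  | tail {y : L} {l l' : List L} (h : LetterStep T l l') : LetterStep T (y :: l) (y :: l')

variable {T : L → L → Prop} {l l' : List L}

theorem LetterStep.swap (h : LetterStep T l l') : LetterStep (fun y z => T z y) l' l := by
  induction h with
  | head h => exact .head h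
  | tail _ ih => exact .tail ih

variable [Lattice L] [OrderBot L]

theorem join_cons (a : L) (l : List L) : join (a :: l) = a ⊔ join l := rfl

theorem join_le_iff {l : List L} {x : L} : join l ≤ x ↔ ∀ a ∈ l, a ≤ x := by
  induction l with
  | nil => simp [join]
  | cons a l ih => rw [join_cons, sup_le_iff, ih, List.forall_mem_cons]

theorem LetterStep.join_le {x : L} (h : LetterStep T l l') (hT : ∀ y z, T y z → z ≤ x)
    (hl : join l ≤ x) : join l' ≤ x := by
  induction h with
  | head h => rw [join_cons] at hl ⊢; exact sup_le (hT _ _ h) (le_sup_right.trans hl)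
  | tail _ ih =>
    rw [join_cons] at hl ⊢
    exact sup_le (le_sup_left.trans hl) (ih (le_sup_right.trans hl))

variable [IsUpperModularLattice L] [Finite L]

/-- Joining with the unchanged letters preserves weak covering. Consequently the excess of the sum
of the ranks over the rank of the join cannot decrease in an upward step. -/
theorem LetterStep.up (h : LetterStep T l l') (hT : ∀ y z, T y z → y ⋖ z) :
    join l ⩿ join l' ∧ (l'.map rk).sum = (l.map rk).sum + 1 := by
  induction h with
  | head h =>
    refine ⟨wcovBy_sup_right (hT _ _ h).wcovBy _, ?_⟩
    simp only [List.map_cons, List.sum_cons, rk_covBy (hT _ _ h)]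
    omega
  | @tail y l l' _ ih =>
    refine ⟨?_, ?_⟩
    · rw [join_cons, join_cons, sup_comm y, sup_comm y]
      exact wcovBy_sup_right ih.1 y
    · simp only [List.map_cons, List.sum_cons, ih.2]
      omega

theorem rk_le_of_wcovBy {a b : L} (h : a ⩿ b) : rk b ≤ rk a + 1 := by
  rcases h.covBy_or_eq with h | h
  · exact (rk_covBy h).le
  · rw [h]; omega

/-- A step upwards preserves dependency; from an independent family it leads to a dependent one
or covers the join. -/
theorem LetterStep.up_cases (h : LetterStep T l l') (hT : ∀ y z, T y z → y ⋖ z) :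
    Dependent l' ∨ (¬ Dependent l ∧ join l ⋖ join l') := by
  obtain ⟨h1, h2⟩ := h.up hT
  have h3 := rk_le_of_wcovBy h1
  have h4 := rk_join_le l
  unfold Dependent
  by_cases hd : rk (join l) < (l.map rk).sum
  · left; omega
  · rcases h1.covBy_or_eq with hc | hc
    · exact Or.inr ⟨hd, hc⟩
    · left; rw [← hc]; omega

/-- A step downwards from a dependent family leads to a dependent one or preserves the join. From
an independent family it leads to an element covered by the join. -/
theorem LetterStep.down_cases (h : LetterStep T l l') (hT : ∀ y z, T y z → z ⋖ y) :
    (Dependent l → Dependent l' ∨ join l' = join l) ∧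
      (¬ Dependent l → join l' ⋖ join l) := by
  obtain ⟨h1, h2⟩ := h.swap.up (fun y z h => hT z y h)
  have h4 := rk_join_le l
  have h5 := rk_join_le l'
  unfold Dependent
  rcases h1.covBy_or_eq with hc | hc
  · have := rk_covBy hc
    exact ⟨fun _ => Or.inl (by omega), fun _ => hc⟩
  -- With unchanged join, the sum of the ranks of `l'` would be one below the rank of its join,
  -- against `rk_join_le`.
  · refine ⟨fun _ => Or.inr hc, fun hd => ?_⟩
    rw [hc] at h5
    omega

end Step

/-! ### Spans of words -/

section Words

variable {K L M : Type*} [Field K] [Lattice L] [AddCommGroup M] [Module K M]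
  [OrderBot L] [IsUpperModularLattice L] [Finite L] (V : LGradedComplex K L M)

/-- The span of the words whose sequence of degrees in `L` satisfies `P`. -/
def wordSpan (P : List L → Prop) : Submodule K (SuperSym V) :=
  Submodule.span K {s | ∃ w, IsWord V w ∧ P (w.map Prod.fst) ∧ s = wordProd V w}

theorem superComp_eq (x : L) : superComp V x = wordSpan V (fun l => join l = x) := rfl

theorem superDeg_eq (i : ℕ) : superDeg V i = wordSpan V (fun l => (l.map rk).sum = i) := by
  simp only [superDeg, wordSpan, List.map_map]
  rfl

variable {V}

theorem wordProd_cons (p : L × M) (w : List (L × M)) :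
    wordProd V (p :: w) = sι V p.2 * wordProd V w := by simp [wordProd]

theorem isWord_cons {p : L × M} {w : List (L × M)} :
    IsWord V (p :: w) ↔ p.2 ∈ V.comp p.1 ∧ IsWord V w := List.forall_mem_cons

theorem wordProd_mem {P : List L → Prop} {w : List (L × M)} (hw : IsWord V w)
    (hP : P (w.map Prod.fst)) : wordProd V w ∈ wordSpan V P :=
  Submodule.subset_span ⟨w, hw, hP, rfl⟩

theorem wordSpan_mono {P Q : List L → Prop} (h : ∀ l, P l → Q l) :
    wordSpan V P ≤ wordSpan V Q :=
  Submodule.span_mono fun _ ⟨w, hw, hP, e⟩ => ⟨w, hw, h _ hP, e⟩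

theorem wordSpan_le {P : List L → Prop} {p : Submodule K (SuperSym V)}
    (h : ∀ w, IsWord V w → P (w.map Prod.fst) → wordProd V w ∈ p) : wordSpan V P ≤ p :=
  Submodule.span_le.2 fun _ ⟨w, hw, hP, e⟩ => e ▸ h w hw hP

theorem wordSpan_top : wordSpan V (fun _ => True) = ⊤ := by
  rw [eq_top_iff]
  intro s _
  refine Submodule.span_mono ?_ (mem_span_words V s)
  rintro _ ⟨w, hw, rfl⟩
  exact ⟨w, hw, trivial, rfl⟩

/-- Super-derivations with respect to the parity automorphism. -/
structure IsSuperDer (e : M →ₗ[K] M) (E : SuperSym V →ₗ[K] SuperSym V) : Prop where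
  ι : ∀ v, E (sι V v) = sι V (e v)
  mul : ∀ a b, E (a * b) = E a * b + superParity V a * E b

theorem isSuperDer_superDiff : IsSuperDer V.diff (superDiff V) :=
  ⟨superDiff_ι V, superDiff_mul V⟩

theorem IsSuperDer.one {e : M →ₗ[K] M} {E : SuperSym V →ₗ[K] SuperSym V} (h : IsSuperDer e E) :
    E 1 = 0 := by
  have : E (1 * 1) = E 1 * 1 + superParity V 1 * E 1 := h.mul 1 1
  rwa [mul_one, mul_one, map_one (superParity V), one_mul, left_eq_add] at this

theorem sι_mul_mem_of_iSup {T : L → Prop} {v : M} (hv : v ∈ ⨆ z, ⨆ _ : T z, V.comp z)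
    {w : List (L × M)} (hw : IsWord V w) {P : List L → Prop}
    (h : ∀ z, T z → P (z :: w.map Prod.fst)) : sι V v * wordProd V w ∈ wordSpan V P := by
  refine V.iSup₂_induction (p := fun v => sι V v * wordProd V w ∈ wordSpan V P) hv ?_ (by simp)
    (fun a b ha hb => by rw [map_add, add_mul]; exact add_mem ha hb)
  intro z hz v hv
  rw [← wordProd_cons (z, v)]
  exact wordProd_mem (isWord_cons.2 ⟨hv, hw⟩) (h z hz)

theorem sι_mul_mem_wordSpan {P Q : List L → Prop} {y : L} {v : M} (hv : v ∈ V.comp y)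
    (h : ∀ l, P l → Q (y :: l)) {s : SuperSym V} (hs : s ∈ wordSpan V P) :
    sι V v * s ∈ wordSpan V Q := by
  have : wordSpan V P ≤ (wordSpan V Q).comap (LinearMap.mulLeft K (sι V v)) := by
    refine wordSpan_le fun w hw hP => ?_
    change sι V v * wordProd V w ∈ wordSpan V Q
    rw [← wordProd_cons (y, v)]
    exact wordProd_mem (isWord_cons.2 ⟨hv, hw⟩) (h _ hP)
  exact this hs

/-- By the Leibniz rule `E` acts on one letter at a time, and parity only contributes scalars. Thus
all questions about how `E` respects the gradings become questions about `LetterStep`. -/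
theorem IsSuperDer.wordProd_mem {e : M →ₗ[K] M} {E : SuperSym V →ₗ[K] SuperSym V}
    (h : IsSuperDer e E) {T : L → L → Prop}
    (he : ∀ y, ∀ v ∈ V.comp y, e v ∈ ⨆ z, ⨆ _ : T y z, V.comp z)
    {w : List (L × M)} (hw : IsWord V w) :
    E (wordProd V w) ∈ wordSpan V (LetterStep T (w.map Prod.fst)) := by
  induction w with
  | nil =>
    have : wordProd V [] = 1 := by simp [wordProd]
    rw [this, h.one]
    exact zero_mem _
  | cons p w ih =>
    obtain ⟨hp, hw⟩ := isWord_cons.1 hw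
    rw [wordProd_cons, h.mul, h.ι, superParity_ι, parity_comp V hp, map_smul, smul_mul_assoc]
    refine add_mem ?_ (Submodule.smul_mem _ _ ?_)
    · exact sι_mul_mem_of_iSup (he _ _ hp) hw fun z hz => .head hz
    · exact sι_mul_mem_wordSpan hp (fun l hl => .tail hl) (ih hw)

theorem IsSuperDer.map_wordSpan {e : M →ₗ[K] M} {E : SuperSym V →ₗ[K] SuperSym V}
    (h : IsSuperDer e E) {T : L → L → Prop}
    (he : ∀ y, ∀ v ∈ V.comp y, e v ∈ ⨆ z, ⨆ _ : T y z, V.comp z) {P Q : List L → Prop}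
    (hPQ : ∀ l l', P l → LetterStep T l l' → Q l') {s : SuperSym V} (hs : s ∈ wordSpan V P) :
    E s ∈ wordSpan V Q := by
  have : wordSpan V P ≤ (wordSpan V Q).comap E :=
    wordSpan_le fun w hw hP => wordSpan_mono (fun l' hl' => hPQ _ l' hP hl')
      (h.wordProd_mem he hw)
  exact this hs

theorem projOn_mem_comp (s : Set L) {x : L} {v : M} (hv : v ∈ V.comp x) :
    V.projOn s v ∈ V.comp x := by
  by_cases h : x ∈ s
  · rwa [V.projOn_of_mem h hv]
  · rw [V.projOn_of_notMem h hv]; exact zero_mem _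

theorem projOn_mem_deg (s : Set L) {i : ℕ} {v : M} (hv : v ∈ V.deg i) :
    V.projOn s v ∈ V.deg i :=
  V.iSup₂_induction (p := fun v => V.projOn s v ∈ V.deg i) hv
    (fun _ hx _ hv => V.mem_iSup₂ (P := fun x => rk x = i) hx (projOn_mem_comp s hv)) (by simp)
    (fun a b ha hb => by rw [map_add]; exact add_mem ha hb)

/-! ### Projections of `S(V)` to lower intervals -/

variable (V) in
/-- The projection of `S(V)` to the words with letters in the components `V_y`, `y ≤ x`. -/
def superProj (x : L) : SuperSym V →ₐ[K] SuperSym V :=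
  superLift V (sι V ∘ₗ V.projOn (Set.Iic x))
    (fun _ _ _ _ hu hv => sι_comm V (projOn_mem_deg _ hu) (projOn_mem_deg _ hv))

theorem superProj_ι (x : L) (v : M) :
    superProj V x (sι V v) = sι V (V.projOn (Set.Iic x) v) := superLift_ι V _ _ v

theorem superProj_word_of_le {x : L} {w : List (L × M)} (hw : IsWord V w)
    (h : join (w.map Prod.fst) ≤ x) : superProj V x (wordProd V w) = wordProd V w := by
  induction w with
  | nil => simp [wordProd]
  | cons p w ih =>
    obtain ⟨hp, hw⟩ := isWord_cons.1 hw
    rw [List.map_cons, join_cons, sup_le_iff] at h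
    rw [wordProd_cons, map_mul, ih hw h.2, superProj_ι,
      V.projOn_of_mem (s := Set.Iic x) h.1 hp]

theorem superProj_word_of_not_le {x : L} {w : List (L × M)} (hw : IsWord V w)
    (h : ¬ join (w.map Prod.fst) ≤ x) : superProj V x (wordProd V w) = 0 := by
  induction w with
  | nil => simp [join] at h
  | cons p w ih =>
    obtain ⟨hp, hw⟩ := isWord_cons.1 hw
    rw [List.map_cons, join_cons, sup_le_iff] at h
    rw [wordProd_cons, map_mul, superProj_ι]
    by_cases hx : p.1 ≤ x
    · rw [ih hw (fun h' => h ⟨hx, h'⟩), mul_zero]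
    · rw [V.projOn_of_notMem (s := Set.Iic x) hx hp, map_zero, zero_mul]

theorem superProj_of_mem {x : L} {P : List L → Prop} (hP : ∀ l, P l → join l ≤ x)
    {s : SuperSym V} (hs : s ∈ wordSpan V P) : superProj V x s = s := by
  have : wordSpan V P ≤ LinearMap.eqLocus (superProj V x).toLinearMap LinearMap.id :=
    wordSpan_le fun w hw h => superProj_word_of_le hw (hP _ h)
  exact this hs

theorem superProj_mem {x : L} {P : List L → Prop} {s : SuperSym V} (hs : s ∈ wordSpan V P) :
    superProj V x s ∈ wordSpan V (fun l => P l ∧ join l ≤ x) := by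
  have : wordSpan V P ≤
      (wordSpan V (fun l => P l ∧ join l ≤ x)).comap (superProj V x).toLinearMap := by
    refine wordSpan_le fun w hw h => ?_
    change superProj V x (wordProd V w) ∈ wordSpan V (fun l => P l ∧ join l ≤ x)
    by_cases hx : join (w.map Prod.fst) ≤ x
    · rw [superProj_word_of_le hw hx]
      exact wordProd_mem hw ⟨h, hx⟩
    · rw [superProj_word_of_not_le hw hx]
      exact zero_mem _
  exact this hs

/-- The dependent words with letters in the components `V_y`, `y ≤ x`. -/
abbrev depBelow (x : L) : Submodule K (SuperSym V) :=
  wordSpan V (fun l => Dependent l ∧ join l ≤ x)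

/-- The projection need not commute with `∂`, so `∂` of a dependent word `w` needs an argument. If
the join of `w` is not below `x`, the terms of `∂ w` that survive have a different join, and by
`LetterStep.down_cases` they are dependent themselves. -/
theorem superProj_osIdeal (x : L) {s : SuperSym V} (hs : s ∈ osIdeal V) :
    superProj V x s ∈ depBelow (V := V) x ⊔ (depBelow (V := V) x).map (superDiff V) := by
  rw [mem_osIdeal] at hs
  obtain ⟨i, hi, _, ⟨j, hj, rfl⟩, rfl⟩ := Submodule.mem_sup.1 hs
  rw [map_add]
  refine add_mem (Submodule.mem_sup_left (superProj_mem hi)) ?_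
  have : depIdeal V ≤ (depBelow (V := V) x ⊔ (depBelow (V := V) x).map (superDiff V)).comap
      ((superProj V x).toLinearMap ∘ₗ superDiff V) := by
    refine wordSpan_le fun w hw hd => ?_
    change superProj V x (superDiff V (wordProd V w)) ∈
      depBelow (V := V) x ⊔ (depBelow (V := V) x).map (superDiff V)
    have hstep := isSuperDer_superDiff.wordProd_mem (T := fun y z => z ⋖ y) V.diff_mem hw
    by_cases hx : join (w.map Prod.fst) ≤ x
    · rw [superProj_of_mem (x := x) (fun l' hl' => ?_) hstep]
      · exact Submodule.mem_sup_right ⟨_, wordProd_mem hw ⟨hd, hx⟩, rfl⟩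
      · exact (hl'.swap.up fun _ _ h => h).1.le.trans hx
    · refine Submodule.mem_sup_left ?_
      have h1 := superProj_mem (x := x) hstep
      refine wordSpan_mono ?_ h1
      rintro l' ⟨hl', hlx⟩
      refine ⟨((hl'.down_cases fun _ _ h => h).1 hd).resolve_right fun e => ?_, hlx⟩
      rw [e] at hlx
      exact hx hlx
  exact this hj

theorem depIdeal_le_osIdeal {s : SuperSym V} (hs : s ∈ depIdeal V) : s ∈ osIdeal V :=
  (mem_osIdeal V).2 (Submodule.mem_sup_left hs)

theorem depBelow_le_depIdeal (x : L) : depBelow (V := V) x ≤ depIdeal V :=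
  wordSpan_mono fun _ h => h.1

theorem superProj_mem_osIdeal (x : L) {s : SuperSym V} (hs : s ∈ osIdeal V) :
    superProj V x s ∈ osIdeal V := by
  rw [mem_osIdeal]
  exact sup_le_sup (depBelow_le_depIdeal x) (Submodule.map_mono (depBelow_le_depIdeal x))
    (superProj_osIdeal x hs)

/-! ### The grading of the generalized Orlik-Solomon algebra -/

/-- The endomorphism of `S(V) / 𝓘(L, V)` induced by a linear endomorphism of `S(V)`. -/
def osMap (E : SuperSym V →ₗ[K] SuperSym V) (hE : ∀ s ∈ osIdeal V, E s ∈ osIdeal V) :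
    OSAlgebra V →ₗ[K] OSAlgebra V where
  toFun := QuotientAddGroup.map (osIdeal V).toAddSubgroup (osIdeal V).toAddSubgroup
    E.toAddMonoidHom (fun s hs => hE s hs)
  map_add' a b := map_add _ a b
  map_smul' r a := by
    obtain ⟨s, rfl⟩ := Ideal.Quotient.mkₐ_surjective K (osIdeal V) a
    exact congrArg (osMk V) (E.map_smul r s)

variable (V) in
theorem osMk_surjective : Function.Surjective (osMk V) :=
  Ideal.Quotient.mkₐ_surjective K (osIdeal V)

theorem osMk_eq_zero_iff {s : SuperSym V} : osMk V s = 0 ↔ s ∈ osIdeal V :=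
  Ideal.Quotient.eq_zero_iff_mem

theorem osMk_eq_zero_of_dependent {w : List (L × M)} (hw : IsWord V w)
    (hd : Dependent (w.map Prod.fst)) : osMk V (wordProd V w) = 0 :=
  osMk_eq_zero_iff.2 (depIdeal_le_osIdeal (wordProd_mem hw hd))

/-- Dependent words vanish in the quotient, so only independent words have to be examined. -/
theorem osMk_mem_of_wordSpan {P : List L → Prop} {p : Submodule K (OSAlgebra V)}
    (h : ∀ w, IsWord V w → P (w.map Prod.fst) → ¬ Dependent (w.map Prod.fst) →
      osMk V (wordProd V w) ∈ p) {s : SuperSym V} (hs : s ∈ wordSpan V P) : osMk V s ∈ p := by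
  have : wordSpan V P ≤ p.comap (osMk V).toLinearMap := by
    refine wordSpan_le fun w hw hP => ?_
    change osMk V (wordProd V w) ∈ p
    by_cases hd : Dependent (w.map Prod.fst)
    · rw [osMk_eq_zero_of_dependent hw hd]; exact zero_mem _
    · exact h w hw hP hd
  exact this hs

theorem mem_osComp {x : L} {v : OSAlgebra V} :
    v ∈ osComp V x ↔ ∃ s ∈ wordSpan V (fun l => join l = x), osMk V s = v := by
  rw [← superComp_eq]
  exact Submodule.mem_map

theorem osMk_word_mem {w : List (L × M)} (hw : IsWord V w) :
    osMk V (wordProd V w) ∈ osComp V (join (w.map Prod.fst)) :=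
  mem_osComp.2 ⟨_, wordProd_mem (P := fun l => join l = _) hw rfl, rfl⟩

theorem osComp_le {x : L} {p : Submodule K (OSAlgebra V)}
    (h : ∀ w, IsWord V w → join (w.map Prod.fst) = x → ¬ Dependent (w.map Prod.fst) →
      osMk V (wordProd V w) ∈ p) : osComp V x ≤ p := by
  intro v hv
  obtain ⟨s, hs, rfl⟩ := mem_osComp.1 hv
  exact osMk_mem_of_wordSpan h hs

/-- The maps `superProj V x` descend to the quotient, where they fix the components at `y ≤ x` and
kill the others. -/
theorem osComp_indep : iSupIndep (osComp V) := by
  refine iSupIndep_of_lower_proj (fun x => (osMap (superProj V x).toLinearMap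
    (fun s hs => superProj_mem_osIdeal x hs)).toAddMonoidHom) ?_ ?_
  · intro x y hxy v hv
    obtain ⟨s, hs, rfl⟩ := mem_osComp.1 hv
    change osMk V (superProj V x s) = osMk V s
    rw [superProj_of_mem (fun l hl => hl.trans_le hxy) hs]
  · intro x y hxy v hv
    obtain ⟨s, hs, rfl⟩ := mem_osComp.1 hv
    change osMk V (superProj V x s) = 0
    have : superProj V x s ∈ wordSpan V (fun _ => False) :=
      wordSpan_mono (P := fun l => join l = y ∧ join l ≤ x) (fun l hl => hxy (hl.1 ▸ hl.2))
        (superProj_mem hs)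
    have h0 : superProj V x s = 0 := by
      rw [← Submodule.mem_bot K]
      exact wordSpan_le (fun _ _ h => h.elim) this
    rw [h0, map_zero]

theorem osComp_span : ⨆ x, osComp V x = ⊤ := by
  rw [eq_top_iff]
  intro v _
  obtain ⟨s, rfl⟩ := osMk_surjective V v
  have : s ∈ wordSpan V (fun _ => True) := by rw [wordSpan_top]; trivial
  exact osMk_mem_of_wordSpan (fun w hw _ _ => le_iSup (osComp V) _ (osMk_word_mem hw)) this

theorem osDiff_mem (x : L) (v : OSAlgebra V) (hv : v ∈ osComp V x) :
    osDiff V v ∈ ⨆ y, ⨆ _ : y ⋖ x, osComp V y := by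
  have : osComp V x ≤ (⨆ y, ⨆ _ : y ⋖ x, osComp V y).comap (osDiff V) := by
    refine osComp_le fun w hw hx hd => ?_
    change osMk V (superDiff V (wordProd V w)) ∈ ⨆ y, ⨆ _ : y ⋖ x, osComp V y
    refine osMk_mem_of_wordSpan (fun w' hw' hstep _ => ?_)
      (isSuperDer_superDiff.wordProd_mem (T := fun y z => z ⋖ y) V.diff_mem hw)
    have hc := (hstep.down_cases fun _ _ h => h).2 hd
    rw [hx] at hc
    exact (le_iSup₂_of_le (f := fun y (_ : y ⋖ x) => osComp V y) _ hc le_rfl)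
      (osMk_word_mem hw')
  exact this hv

variable (V) in
/-- The generalized Orlik-Solomon algebra as an `L`-graded complex. -/
def osComplex : LGradedComplex K L (OSAlgebra V) where
  comp := osComp V
  indep := osComp_indep
  span := osComp_span
  diff := osDiff V
  diff_mem := osDiff_mem
  diff_diff v := by
    obtain ⟨s, rfl⟩ := osMk_surjective V v
    rw [osDiff_mk, osDiff_mk, superDiff_superDiff, map_zero]

/-- For an independent word the sum of the ranks is the rank of the join, so degree and `L`-degree
are compatible. -/
theorem osComplex_deg (i : ℕ) : (osComplex V).deg i = osDeg V i := by
  apply le_antisymm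
  · refine iSup₂_le fun x hx => osComp_le fun w hw hj hd => ?_
    refine Submodule.mem_map_of_mem ?_
    rw [superDeg_eq]
    refine wordProd_mem hw ?_
    have := rk_join_le (w.map Prod.fst)
    unfold Dependent at hd
    rw [← hx, ← hj]
    omega
  · rintro _ ⟨s, hs, rfl⟩
    rw [superDeg_eq] at hs
    refine osMk_mem_of_wordSpan (fun w hw hi hd => ?_) hs
    refine (le_iSup₂_of_le (f := fun x (_ : rk x = i) => osComp V x) (join (w.map Prod.fst)) ?_
      le_rfl) (osMk_word_mem hw)
    have := rk_join_le (w.map Prod.fst)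
    unfold Dependent at hd
    omega

end Words

/-! ### Inverting an endomorphism on its eigenvectors -/

section Eigen

/-- In characteristic zero distinct natural numbers are distinct eigenvalues, so their eigenspaces
are independent. The inverse is defined on their direct sum and extended to `E` by means of a left
inverse of the inclusion. For `k = 0` the convention `0⁻¹ = 0` makes `P` vanish; only `k ≥ 1` is
used later. -/
theorem exists_eigen_inverse {K E : Type*} [Field K] [CharZero K] [AddCommGroup E] [Module K E]
    (N : E →ₗ[K] E) : ∃ P : E →ₗ[K] E, ∀ (k : ℕ) (v : E), N v = (k : K) • v →
      P v = (k : K)⁻¹ • v := by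
  classical
  have hind : iSupIndep fun k : ℕ => Module.End.eigenspace N (k : K) :=
    (Module.End.eigenspaces_iSupIndep N).comp Nat.cast_injective
  obtain ⟨g, hg⟩ := LinearMap.exists_leftInverse_of_injective
    (DirectSum.coeLinearMap fun k : ℕ => Module.End.eigenspace N (k : K))
    (LinearMap.ker_eq_bot.2 hind.dfinsupp_lsum_injective)
  refine ⟨DirectSum.toModule K ℕ E
    (fun k => (k : K)⁻¹ • (Module.End.eigenspace N (k : K)).subtype) ∘ₗ g, fun k v hv => ?_⟩
  have hv' : v ∈ Module.End.eigenspace N (k : K) := Module.End.mem_eigenspace_iff.2 hv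
  have h1 : g v = DirectSum.lof K ℕ (fun k : ℕ => Module.End.eigenspace N (k : K)) k ⟨v, hv'⟩ := by
    have := LinearMap.congr_fun hg
      (DirectSum.lof K ℕ (fun k : ℕ => Module.End.eigenspace N (k : K)) k ⟨v, hv'⟩)
    rw [LinearMap.comp_apply, DirectSum.coeLinearMap_lof] at this
    exact this
  rw [LinearMap.comp_apply, h1, DirectSum.toModule_lof]
  rfl

end Eigen

section Words

variable {K L M : Type*} [Field K] [Lattice L] [AddCommGroup M] [Module K M]
  [OrderBot L] [IsUpperModularLattice L] [Finite L] {V : LGradedComplex K L M}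

/-! ### The super-derivation induced by a homotopy -/

/-- As for `superDiff`, a super-derivation is the upper right entry of an algebra homomorphism `a ↦
(σ a, E a; 0, a)`. The universal property of `S(V)` provides it, because the signs match for a map
`e` that changes the parity. -/
theorem exists_isSuperDer (e : M →ₗ[K] M) (he : ∀ i, ∀ v ∈ V.deg i, e v ∈ V.deg (i + 1)) :
    ∃ E : SuperSym V →ₗ[K] SuperSym V, IsSuperDer e E := by
  let f : M →ₗ[K] Matrix (Fin 2) (Fin 2) (SuperSym V) :=
    { toFun := fun v => !![sι V (parity V v), sι V (e v); 0, sι V v]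
      map_add' := by intro v w; ext i j; fin_cases i <;> fin_cases j <;> simp
      map_smul' := by intro r v; ext i j; fin_cases i <;> fin_cases j <;> simp }
  have hf : ∀ i j u v, u ∈ V.deg i → v ∈ V.deg j →
      f u * f v = (-1 : K) ^ (i * j) • (f v * f u) := by
    intro i j u v hu hv
    have key : (-1 : K) ^ i • (sι V u * sι V (e v)) + sι V (e u) * sι V v =
        (-1 : K) ^ (i * j) • ((-1 : K) ^ j • (sι V v * sι V (e u)) +
          sι V (e v) * sι V u) := by
      have h1 : sι V (e u) * sι V v = (-1 : K) ^ (i * j + j) • (sι V v * sι V (e u)) := by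
        rw [sι_comm V (he i u hu) hv]
        congr 2
        ring
      have h2 : (-1 : K) ^ i • (sι V u * sι V (e v)) =
          (-1 : K) ^ (i * j) • (sι V (e v) * sι V u) := by
        rw [sι_comm V hu (he j v hv), smul_smul]
        congr 1
        rw [← pow_add, show i + i * (j + 1) = i * j + (i + i) by ring, pow_add _ _ (i + i),
          Even.neg_one_pow ⟨i, rfl⟩, mul_one]
      rw [h1, h2, smul_add, smul_smul, ← pow_add, add_comm]
    ext a b
    fin_cases a <;> fin_cases b
    · simpa [f, Matrix.mul_apply, Fin.sum_univ_two] using sι_parity_comm V hu hv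
    · simpa [f, Matrix.mul_apply, Fin.sum_univ_two, parity_deg V hu, parity_deg V hv] using key
    · simp [f, Matrix.mul_apply, Fin.sum_univ_two]
    · simpa [f, Matrix.mul_apply, Fin.sum_univ_two] using sι_comm V hu hv
  let F := superLift V f hf
  have hF : ∀ v, F (sι V v) = f v := superLift_ι V f hf
  have hF' : ∀ s, F s 0 0 = superParity V s ∧ F s 1 0 = 0 ∧ F s 1 1 = s := by
    intro s
    induction s using super_induction with
    | h0 r => simp [Algebra.algebraMap_eq_smul_one]
    | h1 v => simp [hF, f, superParity_ι]
    | hmul a b ha hb => simp [Matrix.mul_apply, Fin.sum_univ_two, ha, hb]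
    | hadd a b ha hb => simp [ha, hb]
  refine ⟨{ toFun := fun s => F s 0 1, map_add' := ?_, map_smul' := ?_ }, ?_, ?_⟩
  · intro a b; simp
  · intro r a; simp
  · intro v
    change F (sι V v) 0 1 = _
    simp [hF, f]
  · intro a b
    change F (a * b) 0 1 = F a 0 1 * b + superParity V a * F b 0 1
    rw [map_mul, Matrix.mul_apply, Fin.sum_univ_two, (hF' a).1, (hF' b).2.2, add_comm]

theorem isSuperDer_anticomm_parity {e : M →ₗ[K] M} {E : SuperSym V →ₗ[K] SuperSym V}
    (h : IsSuperDer e E) (he : ∀ i, ∀ v ∈ V.deg i, e v ∈ V.deg (i + 1)) (s : SuperSym V) :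
    E (superParity V s) = - superParity V (E s) := by
  have hp : ∀ v, e (parity V v) = - parity V (e v) := by
    refine V.comp_induction (fun x v hv => ?_) (by simp)
      (fun a b ha hb => by simp only [map_add, ha, hb, neg_add])
    rw [parity_comp V hv, parity_deg V (he _ v (comp_le_deg V x hv)), map_smul, pow_succ]
    simp
  induction s using super_induction with
  | h0 r => simp [Algebra.algebraMap_eq_smul_one, h.one]
  | h1 v => rw [superParity_ι, h.ι, h.ι, superParity_ι, hp, map_neg]
  | hmul a b ha hb =>
    simp only [h.mul, ha, hb, map_mul, map_add, superParity_superParity]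
    rw [neg_mul, mul_neg, neg_add]
  | hadd a b ha hb => simp [ha, hb, add_comm]

variable {x : L} {d : M →ₗ[K] M} {D : SuperSym V →ₗ[K] SuperSym V}

/-- The data of a homotopy of `V_{≤ x}`, extended by zero, and of the super-derivation which
extends it to `S(V)`. -/
structure IsHomotopyDer (V : LGradedComplex K L M) (x : L) (d : M →ₗ[K] M)
    (D : SuperSym V →ₗ[K] SuperSym V) : Prop where
  mem : ∀ y, ∀ v ∈ V.comp y, d v ∈ ⨆ z, ⨆ _ : y ⋖ z ∧ z ≤ x, V.comp z
  homotopy : ∀ y ≤ x, y ≠ ⊥ → ∀ v ∈ V.comp y, d (V.diff v) + V.diff (d v) = v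
  der : IsSuperDer d D
  parity : ∀ s, D (superParity V s) = - superParity V (D s)

theorem exists_isHomotopyDer (h : (V.lower x).LHomotopy) : ∃ d D, IsHomotopyDer V x d D := by
  obtain ⟨d, hd, hbot, hzero⟩ := h.exists_isHomotopyAt
  have hmem : ∀ y, ∀ v ∈ V.comp y, d v ∈ ⨆ z, ⨆ _ : y ⋖ z ∧ z ≤ x, V.comp z := by
    intro y v hv
    by_cases hy : y ≤ x
    · by_cases hy0 : y = ⊥
      · subst hy0; exact hbot v hv
      · exact hd.mem y hy hy0 v hv
    · rw [hzero y hy v hv]; exact zero_mem _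
  have hdeg : ∀ i, ∀ v ∈ V.deg i, d v ∈ V.deg (i + 1) := by
    intro i v hv
    refine V.iSup₂_induction (p := fun v => d v ∈ V.deg (i + 1)) hv (fun y hy v hv => ?_)
      (by simp) (fun a b ha hb => by rw [map_add]; exact add_mem ha hb)
    exact V.iSup₂_mono' (fun z hz => by rw [rk_covBy hz.1, hy]) (hmem y v hv)
  obtain ⟨D, hD⟩ := exists_isSuperDer d hdeg
  exact ⟨d, D, hmem, hd.homotopy, hD, isSuperDer_anticomm_parity hD hdeg⟩

/-- Words in eigenvectors of the weight operator `∂D + D∂`, with a positive weight if some letter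
has positive degree. -/
def eigenWord (V : LGradedComplex K L M) (D : SuperSym V →ₗ[K] SuperSym V) (l : List L) :
    Submodule K (SuperSym V) :=
  Submodule.span K {s | ∃ (w : List (L × M)) (k : ℕ), IsWord V w ∧ w.map Prod.fst = l ∧
    s = wordProd V w ∧ superDiff V (D s) + D (superDiff V s) = (k : K) • s ∧
    ((∃ a ∈ l, a ≠ ⊥) → 1 ≤ k)}

namespace IsHomotopyDer

theorem weight_one (h : IsHomotopyDer V x d D) :
    superDiff V (D 1) + D (superDiff V 1) = 0 := by
  rw [h.der.one, isSuperDer_superDiff.one, map_zero, map_zero, add_zero]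

/-- The anticommutator of two odd super-derivations is an ordinary derivation: the mixed terms
cancel because `D` and `∂` anticommute with the parity automorphism. -/
theorem weight_ι_mul (h : IsHomotopyDer V x d D) (v : M) (s : SuperSym V) :
    superDiff V (D (sι V v * s)) + D (superDiff V (sι V v * s)) =
      sι V (d (V.diff v) + V.diff (d v)) * s +
        sι V v * (superDiff V (D s) + D (superDiff V s)) := by
  simp only [h.der.mul, superDiff_mul, map_add, h.parity, superDiff_parity, h.der.ι, superDiff_ι,
    superParity_superParity, add_mul, mul_add]
  rw [neg_mul, neg_mul]
  abel

/-- On `V_⊥` the weight operator is `∂ d`, as `∂` vanishes there. It is idempotent: `d v` is a sum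
of elements at atoms below `x`, where `d ∂ + ∂ d = id` gives `∂ d ∂ = ∂`. -/
theorem weight_idem (h : IsHomotopyDer V x d D) {v : M} (hv : v ∈ V.comp ⊥) :
    V.diff (d v) ∈ V.comp ⊥ ∧ V.diff (d (V.diff (d v))) = V.diff (d v) := by
  have h1 := h.mem ⊥ v hv
  refine V.iSup₂_induction
    (p := fun u => V.diff u ∈ V.comp ⊥ ∧ V.diff (d (V.diff u)) = V.diff u) h1 ?_ (by simp) ?_
  · rintro z ⟨hz, hzx⟩ u hu
    constructor
    · refine SetLike.le_def.1 (iSup₂_le fun y hy => ?_) (V.diff_mem z u hu)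
      have e1 := rk_covBy hy
      rw [rk_eq_one_iff.2 hz] at e1
      rw [rk_eq_zero_iff.1 (by omega : rk y = 0)]
    · have := h.homotopy z hzx hz.ne' u hu
      rw [← eq_sub_iff_add_eq] at this
      rw [this, map_sub, V.diff_diff, sub_zero]
  · rintro a b ⟨ha, ha'⟩ ⟨hb, hb'⟩
    simp only [map_add]
    exact ⟨add_mem ha hb, by rw [ha', hb']⟩

/-- Weights of letters add up. A letter of positive degree has weight one; a letter `u ∈ V_⊥` splits
into `∂ d u` of weight one and `u - ∂ d u` of weight zero. The splitting does not change the degrees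
of the letters in `L`. -/
theorem mem_eigenWord (h : IsHomotopyDer V x d D) {w : List (L × M)} (hw : IsWord V w)
    (hx : join (w.map Prod.fst) ≤ x) : wordProd V w ∈ eigenWord V D (w.map Prod.fst) := by
  induction w with
  | nil =>
    refine Submodule.subset_span ⟨[], 0, hw, rfl, rfl, ?_, by simp⟩
    simp only [wordProd, List.map_nil, List.prod_nil]
    rw [h.weight_one, Nat.cast_zero, zero_smul]
  | cons p w ih =>
    obtain ⟨y, u⟩ := p
    obtain ⟨hp, hw⟩ := isWord_cons.1 hw
    rw [List.map_cons, join_cons, sup_le_iff] at hx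
    have key : ∀ (v : M) (c : ℕ), v ∈ V.comp y → d (V.diff v) + V.diff (d v) = (c : K) • v →
        (y ≠ ⊥ → 1 ≤ c) →
        sι V v * wordProd V w ∈ eigenWord V D (y :: w.map Prod.fst) := by
      intro v c hv hc hc1
      have : eigenWord V D (w.map Prod.fst) ≤
          (eigenWord V D (y :: w.map Prod.fst)).comap (LinearMap.mulLeft K (sι V v)) := by
        refine Submodule.span_le.2 ?_
        rintro _ ⟨w', k, hw', hl, rfl, hk, hk1⟩
        refine Submodule.subset_span ⟨(y, v) :: w', c + k, isWord_cons.2 ⟨hv, hw'⟩, ?_, ?_, ?_, ?_⟩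
        · rw [List.map_cons, hl]
        · rw [LinearMap.mulLeft_apply, wordProd_cons]
        · rw [LinearMap.mulLeft_apply, h.weight_ι_mul, hc, hk, map_smul, smul_mul_assoc,
            mul_smul_comm, Nat.cast_add, add_smul]
        · rintro ⟨a, ha, ha0⟩
          rcases List.mem_cons.1 ha with rfl | ha
          · have := hc1 ha0; omega
          · have := hk1 ⟨a, ha, ha0⟩; omega
      exact this (ih hw hx.2)
    rw [wordProd_cons, List.map_cons]
    change sι V u * wordProd V w ∈ eigenWord V D (y :: w.map Prod.fst)
    by_cases hy : y = ⊥
    · subst hy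
      obtain ⟨h1, h2⟩ := h.weight_idem hp
      have e : sι V u * wordProd V w = sι V (V.diff (d u)) * wordProd V w +
          sι V (u - V.diff (d u)) * wordProd V w := by
        rw [← add_mul, ← map_add, add_sub_cancel]
      rw [e]
      refine add_mem (key _ 1 h1 ?_ (by simp)) (key _ 0 (sub_mem hp h1) ?_ (by simp))
      · rw [V.diff_diff, map_zero, zero_add, h2, Nat.cast_one, one_smul]
      · rw [map_sub V.diff, map_sub d, map_sub d, map_sub V.diff, V.diff_comp_bot hp, V.diff_diff,
          h2]
        simp
    · exact key u 1 hp (by rw [h.homotopy y hx.1 hy u hp, Nat.cast_one, one_smul]) (by simp)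

theorem weight_mem (h : IsHomotopyDer V x d D) {P : List L → Prop}
    (hP : ∀ l, P l → join l ≤ x) {s : SuperSym V} (hs : s ∈ wordSpan V P) :
    superDiff V (D s) + D (superDiff V s) ∈ wordSpan V P := by
  let N := superDiff V ∘ₗ D + D ∘ₗ superDiff V
  have : wordSpan V P ≤ (wordSpan V P).comap N := by
    refine wordSpan_le fun w hw hPw => ?_
    have h1 : eigenWord V D (w.map Prod.fst) ≤ (wordSpan V P).comap N := by
      refine Submodule.span_le.2 ?_
      rintro _ ⟨w', k, hw', hl, rfl, hk, -⟩
      change superDiff V (D (wordProd V w')) + D (superDiff V (wordProd V w')) ∈ wordSpan V P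
      rw [hk]
      exact Submodule.smul_mem _ _ (GenOS.wordProd_mem hw' (hl ▸ hPw))
    exact h1 (h.mem_eigenWord hw (hP _ hPw))
  exact this hs

theorem map_depIdeal (h : IsHomotopyDer V x d D) {P : List L → Prop} (hP : ∀ l, P l → Dependent l)
    {s : SuperSym V} (hs : s ∈ wordSpan V P) : D s ∈ depIdeal V :=
  h.der.map_wordSpan (T := fun y z => y ⋖ z ∧ z ≤ x) h.mem
    (fun _ _ hl hstep => (hstep.up_cases fun _ _ h => h.1).resolve_right
      fun h => h.1 (hP _ hl)) hs

/-- For `j` in the span of the dependent words below `x`, `D ∂ j = N j - ∂ D j`. The weight operator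
`N` preserves this span, and `D j ∈ I` since upward steps keep dependency. The projection comes
first because `N` is controlled only on words below `x`. -/
theorem map_osIdeal (h : IsHomotopyDer V x d D) {s : SuperSym V} (hs : s ∈ osIdeal V) :
    (D ∘ₗ (superProj V x).toLinearMap) s ∈ osIdeal V := by
  change D (superProj V x s) ∈ osIdeal V
  obtain ⟨i, hi, _, ⟨j, hj, rfl⟩, e⟩ := Submodule.mem_sup.1 (superProj_osIdeal x hs)
  rw [← e, map_add]
  refine add_mem (depIdeal_le_osIdeal (h.map_depIdeal (fun _ h => h.1) hi)) ?_
  have h1 := h.weight_mem (fun _ h => h.2) hj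
  have h2 := depIdeal_le_osIdeal (depBelow_le_depIdeal x h1)
  have h3 := superDiff_mem_osIdeal V
    (depIdeal_le_osIdeal (h.map_depIdeal (fun _ h => h.1) hj))
  have := sub_mem h2 h3
  rwa [add_sub_cancel_left] at this

/-! ### Contractibility of the generalized Orlik-Solomon algebra -/

/-- The endomorphism of the generalized Orlik-Solomon algebra induced by `D`. -/
def osD (h : IsHomotopyDer V x d D) : OSAlgebra V →ₗ[K] OSAlgebra V :=
  osMap (D ∘ₗ (superProj V x).toLinearMap) (fun _ hs => h.map_osIdeal hs)

theorem osD_mk (h : IsHomotopyDer V x d D) {P : List L → Prop} (hP : ∀ l, P l → join l ≤ x)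
    {s : SuperSym V} (hs : s ∈ wordSpan V P) : h.osD (osMk V s) = osMk V (D s) := by
  change osMk V (D (superProj V x s)) = _
  rw [superProj_of_mem hP hs]

theorem osD_mem (h : IsHomotopyDer V x d D) {y : L} (hy : y ≤ x) {v : OSAlgebra V}
    (hv : v ∈ osComp V y) : h.osD v ∈ ⨆ z, ⨆ _ : y ⋖ z ∧ z ≤ x, osComp V z := by
  have : osComp V y ≤ (⨆ z, ⨆ _ : y ⋖ z ∧ z ≤ x, osComp V z).comap h.osD := by
    refine osComp_le fun w hw hj hd => ?_
    change h.osD (osMk V (wordProd V w)) ∈ ⨆ z, ⨆ _ : y ⋖ z ∧ z ≤ x, osComp V z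
    rw [h.osD_mk (P := fun l => join l = y) (fun l hl => hl.trans_le hy)
      (GenOS.wordProd_mem hw hj)]
    refine osMk_mem_of_wordSpan (fun w' hw' hstep hd' => ?_)
      (h.der.wordProd_mem (T := fun y z => y ⋖ z ∧ z ≤ x) h.mem hw)
    have hc := ((hstep.up_cases fun _ _ h => h.1).resolve_left hd').2
    have hx := hstep.join_le (fun _ _ h => h.2) (hj.trans_le hy)
    rw [hj] at hc
    exact (le_iSup₂_of_le (f := fun z (_ : y ⋖ z ∧ z ≤ x) => osComp V z) _ ⟨hc, hx⟩ le_rfl)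
      (osMk_word_mem hw')
  exact this hv

/-- A word with join `y ≠ ⊥` has a letter of positive degree, so all weights that occur in it are
positive. -/
theorem osComp_le_eigen (h : IsHomotopyDer V x d D) {y : L} (hy : y ≤ x) (hy0 : y ≠ ⊥) :
    osComp V y ≤ Submodule.span K {v | v ∈ osComp V y ∧ ∃ k : ℕ, 1 ≤ k ∧
      osDiff V (h.osD v) + h.osD (osDiff V v) = (k : K) • v} := by
  refine osComp_le fun w hw hj hd => ?_
  have hex : ∃ a ∈ w.map Prod.fst, a ≠ ⊥ := by
    by_contra! hcon
    apply hy0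
    rw [← hj, eq_bot_iff, join_le_iff]
    exact fun a ha => (hcon a ha).le
  have : eigenWord V D (w.map Prod.fst) ≤ (Submodule.span K {v | v ∈ osComp V y ∧ ∃ k : ℕ, 1 ≤ k ∧
      osDiff V (h.osD v) + h.osD (osDiff V v) = (k : K) • v}).comap (osMk V).toLinearMap := by
    refine Submodule.span_le.2 ?_
    rintro _ ⟨w', k, hw', hl, rfl, hk, hk1⟩
    refine Submodule.subset_span ⟨?_, k, hk1 hex, ?_⟩
    · have := osMk_word_mem hw'
      rw [hl, hj] at this
      exact this
    · change osDiff V (h.osD (osMk V (wordProd V w'))) +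
        h.osD (osDiff V (osMk V (wordProd V w'))) = (k : K) • osMk V (wordProd V w')
      rw [← map_smul, ← hk, map_add, osDiff_mk,
        h.osD_mk (P := fun l => join l = y) (fun l hl => hl.trans_le hy)
          (GenOS.wordProd_mem hw' (by rw [hl, hj])), osDiff_mk,
        h.osD_mk (fun l' hl' => ?_)
          (isSuperDer_superDiff.wordProd_mem (T := fun y z => z ⋖ y) V.diff_mem hw')]
      rw [hl] at hl'
      exact (hl'.swap.up fun _ _ h => h).1.le.trans (hj.trans_le hy)
  exact this (h.mem_eigenWord hw (hj.trans_le hy))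

/-- The homotopy is `D N⁻¹`. It suffices to check it on eigenvectors `v` of weight `k ≥ 1`, where
both terms of the homotopy equation carry the factor `k⁻¹` and `(∂ D + D ∂) v = k v`. -/
theorem exists_osIsHomotopyAt [CharZero K] (h : IsHomotopyDer V x d D) :
    ∃ H, (osComplex V).IsHomotopyAt x H := by
  obtain ⟨P, hP⟩ := exists_eigen_inverse (osDiff V ∘ₗ h.osD + h.osD ∘ₗ osDiff V)
  have hdd : ∀ v, osDiff V (osDiff V v) = 0 := (osComplex V).diff_diff
  refine ⟨h.osD ∘ₗ P, ⟨fun y hy hy0 v hv => ?_, fun y hy hy0 v hv => ?_⟩⟩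
  · refine Submodule.span_induction (p := fun v _ => (h.osD ∘ₗ P) v ∈
      ⨆ z, ⨆ _ : y ⋖ z ∧ z ≤ x, (osComplex V).comp z) ?_ (by simp)
      (fun a b _ _ ha hb => by rw [map_add]; exact add_mem ha hb)
      (fun c a _ ha => by rw [map_smul]; exact Submodule.smul_mem _ c ha)
      (h.osComp_le_eigen hy hy0 hv)
    rintro v ⟨hv, k, hk1, hk⟩
    rw [LinearMap.comp_apply, hP k v hk, map_smul]
    exact Submodule.smul_mem _ _ (h.osD_mem hy hv)
  · change (h.osD ∘ₗ P) (osDiff V v) + osDiff V ((h.osD ∘ₗ P) v) = v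
    refine Submodule.span_induction
      (p := fun v _ => (h.osD ∘ₗ P) (osDiff V v) + osDiff V ((h.osD ∘ₗ P) v) = v) ?_ (by simp)
      (fun a b _ _ ha hb => by
        rw [map_add, map_add, map_add, map_add, add_add_add_comm, ha, hb])
      (fun c a _ ha => by rw [map_smul, map_smul, map_smul, map_smul, ← smul_add, ha])
      (h.osComp_le_eigen hy hy0 hv)
    rintro v ⟨hv, k, hk1, hk⟩
    -- `N` commutes with `∂` because `∂² = 0`, so `∂ v` has the same weight as `v`.
    have hk' : (osDiff V ∘ₗ h.osD + h.osD ∘ₗ osDiff V) (osDiff V v) = (k : K) • osDiff V v := by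
      change osDiff V (h.osD (osDiff V v)) + h.osD (osDiff V (osDiff V v)) = _
      rw [← map_smul, ← hk, map_add, hdd, hdd, map_zero, add_zero, zero_add]
    have hk0 : (k : K) ≠ 0 := Nat.cast_ne_zero.2 (by omega)
    rw [LinearMap.comp_apply, LinearMap.comp_apply, hP k v hk, hP k _ hk', map_smul, map_smul,
      map_smul, ← smul_add, add_comm, hk, smul_smul, inv_mul_cancel₀ hk0, one_smul]

end IsHomotopyDer

theorem exists_osIsHomotopyAt [CharZero K] (hV : V.LContractible) (x : L) :
    ∃ H, (osComplex V).IsHomotopyAt x H := by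
  obtain ⟨h⟩ := hV x
  obtain ⟨d, D, hD⟩ := exists_isHomotopyDer h
  exact hD.exists_osIsHomotopyAt

end Words

section Words

variable {K L M : Type*} [Field K] [Lattice L] [AddCommGroup M] [Module K M]
  [OrderBot L] [IsUpperModularLattice L] [Finite L] (V : LGradedComplex K L M)

/-! ### The structure over `Sym V_0` -/

/-- The canonical homomorphism `Sym V_0 → S(V)`. -/
def symHom : SymmetricAlgebra K (V.comp ⊥) →ₐ[K] SuperSym V :=
  (Subalgebra.center K (SuperSym V)).val.comp (symToSuper V)

theorem symHom_ι (u : V.comp ⊥) : symHom V (SymmetricAlgebra.ι K _ u) = sι V u := by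
  change ((symToSuper V (SymmetricAlgebra.ι K _ u) : Subalgebra.center K (SuperSym V)) :
    SuperSym V) = _
  rw [symToSuper, SymmetricAlgebra.lift_ι_apply]
  rfl

theorem symHom_comm (r : SymmetricAlgebra K (V.comp ⊥)) (s : SuperSym V) :
    s * symHom V r = symHom V r * s :=
  Subalgebra.mem_center_iff.1 (symToSuper V r).2 s

theorem smul_osMk (r : SymmetricAlgebra K (V.comp ⊥)) (s : SuperSym V) :
    r • osMk V s = osMk V (symHom V r * s) := (map_mul (osMk V) (symHom V r) s).symm

theorem algebraMap_osAlgebra (r : SymmetricAlgebra K (V.comp ⊥)) :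
    algebraMap _ (OSAlgebra V) r = osMk V (symHom V r) := rfl

/-- This allows `Sym V_0`-submodules to be regarded as `K`-subspaces, to which the arguments with
spans of words apply. -/
instance : IsScalarTower K (SymmetricAlgebra K (V.comp ⊥)) (OSAlgebra V) :=
  IsScalarTower.of_algebraMap_smul fun c v => by
    obtain ⟨s, rfl⟩ := osMk_surjective V v
    rw [smul_osMk, AlgHom.commutes, ← Algebra.smul_def, map_smul]

theorem superDiff_symHom (r : SymmetricAlgebra K (V.comp ⊥)) :
    superDiff V (symHom V r) = 0 ∧ superParity V (symHom V r) = symHom V r := by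
  induction r using SymmetricAlgebra.induction with
  | algebraMap c =>
    rw [AlgHom.commutes]
    exact ⟨superDiff_algebraMap V c, AlgHom.commutes _ c⟩
  | ι u =>
    rw [symHom_ι, superDiff_ι, superParity_ι, V.diff_comp_bot u.2, parity_comp V u.2, rk_bot]
    simp
  | mul a b ha hb => simp [superDiff_mul, ha, hb]
  | add a b ha hb => simp [ha, hb]

variable {V}

theorem osDiff_smul (r : SymmetricAlgebra K (V.comp ⊥)) (v : OSAlgebra V) :
    osDiff V (r • v) = r • osDiff V v := by
  obtain ⟨s, rfl⟩ := osMk_surjective V v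
  rw [smul_osMk, osDiff_mk, osDiff_mk, smul_osMk, superDiff_mul, (superDiff_symHom V r).1,
    (superDiff_symHom V r).2, zero_mul, zero_add]

theorem mul_mem_wordSpan {P Q T : List L → Prop} (h : ∀ l l', P l → Q l' → T (l ++ l'))
    {a b : SuperSym V} (ha : a ∈ wordSpan V P) (hb : b ∈ wordSpan V Q) :
    a * b ∈ wordSpan V T := by
  have := Submodule.mul_mem_mul ha hb
  rw [wordSpan, wordSpan, Submodule.span_mul_span] at this
  refine Submodule.span_le.2 ?_ this
  rintro _ ⟨_, ⟨w, hw, hP, rfl⟩, _, ⟨w', hw', hQ, rfl⟩, rfl⟩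
  refine Submodule.subset_span ⟨w ++ w', ?_, ?_, by simp [wordProd]⟩
  · intro p hp
    rcases List.mem_append.1 hp with h | h
    · exact hw p h
    · exact hw' p h
  · rw [List.map_append]
    exact h _ _ hP hQ

theorem symHom_mem (r : SymmetricAlgebra K (V.comp ⊥)) :
    symHom V r ∈ wordSpan V (fun l => join l = ⊥) := by
  induction r using SymmetricAlgebra.induction with
  | algebraMap c =>
    rw [AlgHom.commutes, Algebra.algebraMap_eq_smul_one]
    have := wordProd_mem (V := V) (P := fun l => join l = ⊥) (w := []) (by simp [IsWord]) rfl
    exact Submodule.smul_mem _ c this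
  | ι u =>
    rw [symHom_ι]
    have := wordProd_mem (V := V) (P := fun l => join l = ⊥) (w := [(⊥, (u : M))])
      (by simp [IsWord]) (by simp [join])
    simpa [wordProd] using this
  | mul a b ha hb =>
    rw [map_mul]
    exact mul_mem_wordSpan (fun l l' h h' => by rw [join_append, h, h', sup_bot_eq]) ha hb
  | add a b ha hb => rw [map_add]; exact add_mem ha hb

theorem smul_mem_osComp (r : SymmetricAlgebra K (V.comp ⊥)) {x : L} {v : OSAlgebra V}
    (hv : v ∈ osComp V x) : r • v ∈ osComp V x := by
  obtain ⟨s, hs, rfl⟩ := mem_osComp.1 hv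
  rw [smul_osMk]
  exact mem_osComp.2 ⟨_, mul_mem_wordSpan
    (fun l l' h h' => by rw [join_append, h, h', bot_sup_eq]) (symHom_mem r) hs, rfl⟩

theorem exists_symHom_eq {w : List (L × M)} (hw : IsWord V w) (h : ∀ p ∈ w, p.1 = ⊥) :
    ∃ r, symHom V r = wordProd V w := by
  induction w with
  | nil => exact ⟨1, by simp [wordProd]⟩
  | cons p w ih =>
    obtain ⟨hp, hw⟩ := isWord_cons.1 hw
    rw [List.forall_mem_cons] at h
    obtain ⟨r, hr⟩ := ih hw h.2
    rw [h.1] at hp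
    exact ⟨SymmetricAlgebra.ι K _ ⟨p.2, hp⟩ * r, by rw [map_mul, symHom_ι, hr, wordProd_cons]⟩

/-- Exactly one letter sits at `a`; the others lie in `V_⊥`, are central, and can be collected in
front. -/
theorem exists_symHom_mul_eq {a : L} (ha : IsAtom a) {w : List (L × M)} (hw : IsWord V w)
    (hj : ∀ p ∈ w, p.1 ≤ a) (hr : ((w.map Prod.fst).map rk).sum = 1) :
    ∃ r, ∃ v ∈ V.comp a, wordProd V w = symHom V r * sι V v := by
  induction w with
  | nil => simp at hr
  | cons p w ih =>
    obtain ⟨hp, hw⟩ := isWord_cons.1 hw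
    rw [List.forall_mem_cons] at hj
    rw [List.map_cons, List.map_cons, List.sum_cons] at hr
    rw [wordProd_cons]
    rcases ha.le_iff.1 hj.1 with h | h
    · rw [h, rk_bot, zero_add] at hr
      obtain ⟨r, v, hv, e⟩ := ih hw hj.2 hr
      rw [h] at hp
      exact ⟨SymmetricAlgebra.ι K _ ⟨p.2, hp⟩ * r, v, hv,
        by rw [map_mul, symHom_ι, e, mul_assoc]⟩
    · rw [h, rk_eq_one_iff.2 ha.bot_covBy] at hr
      have hs : ((w.map Prod.fst).map rk).sum = 0 := by omega
      have hbot : ∀ q ∈ w, q.1 = ⊥ := by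
        intro q hq
        rw [List.sum_eq_zero_iff] at hs
        exact rk_eq_zero_iff.1 (hs _ (List.mem_map_of_mem (List.mem_map_of_mem hq)))
      obtain ⟨r, hr⟩ := exists_symHom_eq hw hbot
      rw [h] at hp
      exact ⟨r, p.2, hp, by rw [← hr, symHom_comm]⟩

/-! ### Retraction onto `Sym V_0` -/

variable (V) in
/-- The projection of `S(V)` to `Sym V_0`. -/
def superToSym : SuperSym V →ₐ[K] SymmetricAlgebra K (V.comp ⊥) :=
  superLift V (SymmetricAlgebra.ι K _ ∘ₗ
    LinearMap.codRestrict (V.comp ⊥) (V.projOn {⊥}) (V.projOn_singleton_mem ⊥)) (by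
    -- Letters of positive degree go to zero, so the relations of `S(V)` only have to be checked for
    -- `i = 0`, where the sign is trivial.
    have h0 : ∀ {i : ℕ} {u : M}, i ≠ 0 → u ∈ V.deg i →
        LinearMap.codRestrict (V.comp ⊥) (V.projOn {⊥}) (V.projOn_singleton_mem ⊥) u = 0 := by
      intro i u hi hu
      refine Subtype.ext (V.projOn_eq_zero (P := fun x => rk x = i) ?_ hu)
      rintro x hx rfl
      rw [rk_bot] at hx
      exact hi hx.symm
    intro i j u v hu hv
    rw [LinearMap.comp_apply, LinearMap.comp_apply]
    by_cases hi : i = 0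
    · subst hi
      rw [zero_mul, pow_zero, one_smul, mul_comm]
    · rw [h0 hi hu, map_zero, zero_mul, mul_zero, smul_zero])

theorem superToSym_ι (v : M) : superToSym V (sι V v) =
    SymmetricAlgebra.ι K _ ⟨V.projOn {⊥} v, V.projOn_singleton_mem ⊥ v⟩ :=
  superLift_ι V _ _ v

theorem superToSym_symHom (r : SymmetricAlgebra K (V.comp ⊥)) :
    superToSym V (symHom V r) = r := by
  have : (superToSym V).comp (symHom V) = AlgHom.id K _ := by
    refine SymmetricAlgebra.algHom_ext (LinearMap.ext fun u => ?_)
    change superToSym V (symHom V (SymmetricAlgebra.ι K _ u)) = SymmetricAlgebra.ι K _ u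
    rw [symHom_ι, superToSym_ι]
    congr 1
    exact Subtype.ext (V.projOn_of_mem (s := {⊥}) rfl u.2)
  exact AlgHom.congr_fun this r

theorem superToSym_eq_zero {P : List L → Prop} (hP : ∀ l, P l → join l ≠ ⊥) {s : SuperSym V}
    (hs : s ∈ wordSpan V P) : superToSym V s = 0 := by
  have : wordSpan V P ≤ LinearMap.ker (superToSym V).toLinearMap := by
    refine wordSpan_le fun w hw h => ?_
    change superToSym V (wordProd V w) = 0
    replace h := hP _ h
    clear hs hP
    induction w with
    | nil => exact absurd rfl h
    | cons p w ih =>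
      obtain ⟨hp, hw⟩ := isWord_cons.1 hw
      rw [wordProd_cons, map_mul]
      by_cases hp0 : p.1 = ⊥
      · rw [ih hw (fun h' => h (by rw [List.map_cons, join_cons, hp0, h', sup_bot_eq])), mul_zero]
      · have : (⟨V.projOn {⊥} p.2, V.projOn_singleton_mem ⊥ p.2⟩ : V.comp ⊥) = 0 :=
          Subtype.ext (V.projOn_of_notMem (s := {⊥}) hp0 hp)
        rw [superToSym_ι, this, map_zero, zero_mul]
  exact this hs

theorem join_ne_bot_of_dependent {l : List L} (h : Dependent l) : join l ≠ ⊥ := by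
  intro hb
  have hs : (l.map rk).sum = 0 := by
    refine List.sum_eq_zero fun n hn => ?_
    obtain ⟨a, ha, rfl⟩ := List.mem_map.1 hn
    exact rk_eq_zero_iff.2 (le_bot_iff.1 (join_le_iff.1 hb.le a ha))
  unfold Dependent at h
  omega

/-- The retraction kills words with join `≠ ⊥`. Dependent words are of this kind, and so are the
terms of their differentials, since a downward step from a dependent word keeps either dependency or
the join. Hence `Sym V_0` embeds into the quotient. -/
theorem superToSym_osIdeal {s : SuperSym V} (hs : s ∈ osIdeal V) : superToSym V s = 0 := by
  obtain ⟨i, hi, _, ⟨j, hj, rfl⟩, rfl⟩ := Submodule.mem_sup.1 ((mem_osIdeal V).1 hs)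
  have hj' : superDiff V j ∈ wordSpan V (fun l => join l ≠ ⊥) :=
    isSuperDer_superDiff.map_wordSpan (T := fun y z => z ⋖ y) V.diff_mem
      (fun l l' hl hstep => by
        rcases (hstep.down_cases fun _ _ h => h).1 hl with h | h
        · exact join_ne_bot_of_dependent h
        · rw [h]; exact join_ne_bot_of_dependent hl) hj
  rw [map_add, superToSym_eq_zero (fun _ => join_ne_bot_of_dependent) hi,
    superToSym_eq_zero (fun _ h => h) hj', add_zero]

theorem algebraMap_osAlgebra_injective :
    Function.Injective (algebraMap (SymmetricAlgebra K (V.comp ⊥)) (OSAlgebra V)) := by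
  rw [injective_iff_map_eq_zero]
  intro r hr
  rw [algebraMap_osAlgebra, osMk_eq_zero_iff] at hr
  rw [← superToSym_symHom r, superToSym_osIdeal hr]

variable (V) in
/-- The generalized Orlik-Solomon algebra as an `L`-graded complex of `Sym V_0`-modules. -/
def osComplexSym : LGradedComplex (SymmetricAlgebra K (V.comp ⊥)) L (OSAlgebra V) where
  comp x :=
    { carrier := osComp V x
      add_mem' := fun ha hb => (osComp V x).add_mem ha hb
      zero_mem' := (osComp V x).zero_mem
      smul_mem' := fun r _ hv => smul_mem_osComp r hv }
  indep := iSupIndep_of_proj (fun x => ((osComplex V).projOn {x}).toAddMonoidHom)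
    (fun x _ hv => (osComplex V).projOn_of_mem (s := {x}) rfl hv)
    (fun x _ hy _ hv => (osComplex V).projOn_of_notMem (s := {x}) hy hv)
  span := by
    rw [eq_top_iff]
    intro v _
    refine (osComplex V).comp_induction (p := fun v => v ∈ iSup _) (fun x v hv => ?_)
      (zero_mem _) (fun a b ha hb => add_mem ha hb) v
    exact Submodule.mem_iSup_of_mem x hv
  diff := { osDiff V with map_smul' := osDiff_smul }
  diff_mem x v hv := by
    refine (osComplex V).iSup₂_induction (p := fun v => v ∈ iSup _) (osDiff_mem x v hv)
      (fun y hy v hv => ?_) (zero_mem _) (fun a b ha hb => add_mem ha hb)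
    exact Submodule.mem_iSup_of_mem y (Submodule.mem_iSup_of_mem hy hv)
  diff_diff := (osComplex V).diff_diff

theorem mem_osComplexSym_comp {x : L} {v : OSAlgebra V} :
    v ∈ (osComplexSym V).comp x ↔ v ∈ osComp V x := Iff.rfl

/-- Sums of components do not depend on the ring of scalars, so homotopies that are only `K`-linear
give information on the complex over `Sym V_0`. -/
theorem mem_osComplexSym_iSup {P : L → Prop} {v : OSAlgebra V} :
    v ∈ (⨆ x, ⨆ _ : P x, (osComplexSym V).comp x) ↔
      v ∈ ⨆ x, ⨆ _ : P x, (osComplex V).comp x := by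
  constructor
  · intro h
    exact (osComplexSym V).iSup₂_induction
      (p := fun v => v ∈ ⨆ x, ⨆ _ : P x, (osComplex V).comp x) h
      (fun x hx v hv => (osComplex V).mem_iSup₂ hx hv) (zero_mem _)
      (fun a b ha hb => add_mem ha hb)
  · intro h
    exact (osComplex V).iSup₂_induction
      (p := fun v => v ∈ ⨆ x, ⨆ _ : P x, (osComplexSym V).comp x) h
      (fun x hx v hv => (osComplexSym V).mem_iSup₂ hx hv) (zero_mem _)
      (fun a b ha hb => add_mem ha hb)

theorem range_algebraMap_osAlgebra :
    LinearMap.range (Algebra.linearMap (SymmetricAlgebra K (V.comp ⊥)) (OSAlgebra V)) =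
      (osComplexSym V).comp ⊥ := by
  apply le_antisymm
  · rintro _ ⟨r, rfl⟩
    exact mem_osComp.2 ⟨_, symHom_mem r, rfl⟩
  · have : osComp V ⊥ ≤ (LinearMap.range (Algebra.linearMap (SymmetricAlgebra K (V.comp ⊥))
        (OSAlgebra V))).restrictScalars K := by
      refine osComp_le fun w hw hj _ => ?_
      obtain ⟨r, hr⟩ := exists_symHom_eq hw fun p hp =>
        le_bot_iff.1 (join_le_iff.1 hj.le _ (List.mem_map_of_mem hp))
      exact ⟨r, congrArg (osMk V) hr⟩
    exact fun v hv => this hv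

/-- An independent word with join `a` has rank sum one, hence has the form `r v` with `r` from `Sym
V_0` and `v ∈ V_a`, and `∂ (r v) = r ∂ v`. -/
theorem osComplexSym_map_atom (a : L) (ha : IsAtom a) :
    ((osComplexSym V).comp a).map (osComplexSym V).diff =
      ((idealDatum V).sub a ha).map
        (Algebra.linearMap (SymmetricAlgebra K (V.comp ⊥)) (OSAlgebra V)) := by
  apply le_antisymm
  · rw [Submodule.map_le_iff_le_comap]
    have : osComp V a ≤ ((((idealDatum V).sub a ha).map (Algebra.linearMap
        (SymmetricAlgebra K (V.comp ⊥)) (OSAlgebra V))).comap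
        (osComplexSym V).diff).restrictScalars K := by
      refine osComp_le fun w hw hj hd => ?_
      have hle : ∀ p ∈ w, p.1 ≤ a := fun p hp =>
        join_le_iff.1 hj.le _ (List.mem_map_of_mem hp)
      have hrk : ((w.map Prod.fst).map rk).sum = 1 := by
        have h1 := rk_join_le (w.map Prod.fst)
        have h2 := rk_eq_one_iff.2 ha.bot_covBy
        unfold Dependent at hd
        rw [hj] at h1 hd
        omega
      obtain ⟨r, v, hv, e⟩ := exists_symHom_mul_eq ha hw hle hrk
      have hb : V.diff v ∈ V.comp ⊥ := by
        refine SetLike.le_def.1 (iSup₂_le fun y hy => ?_) (V.diff_mem a v hv)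
        rw [ha.lt_iff.1 hy.lt]
      refine ⟨r * SymmetricAlgebra.ι K _ ⟨V.diff v, hb⟩,
        Ideal.mul_mem_left _ r (Ideal.subset_span ⟨⟨V.diff v, hb⟩, ⟨v, hv, rfl⟩, rfl⟩), ?_⟩
      change osMk V (symHom V _) = osDiff V (osMk V (wordProd V w))
      rw [e, osDiff_mk, superDiff_mul, (superDiff_symHom V r).1, (superDiff_symHom V r).2,
        zero_mul, zero_add, superDiff_ι, map_mul, symHom_ι]
    exact fun v hv => this hv
  · rw [Submodule.map_le_iff_le_comap]
    refine Ideal.span_le.2 ?_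
    rintro _ ⟨u, ⟨v, hv, hu⟩, rfl⟩
    refine ⟨osMk V (sι V v), ?_, ?_⟩
    · have := osMk_word_mem (V := V) (w := [(a, v)]) (by simpa [IsWord] using hv)
      exact mem_osComplexSym_comp.2 (by simpa [wordProd, join] using this)
    · change osDiff V (osMk V (sι V v)) = osMk V (symHom V (SymmetricAlgebra.ι K _ u))
      rw [osDiff_mk, superDiff_ι, hu, symHom_ι]

end Words

/-! ### Exactness of contractible complexes -/

namespace LGradedComplex

variable {K L M : Type*} [Field K] [Lattice L] [AddCommGroup M] [Module K M]
  [OrderBot L] [IsUpperModularLattice L] [Finite L] {V : LGradedComplex K L M} {x : L}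
  {H : M →ₗ[K] M}

/-- Nothing in `L_{≤ x}` covers `x`, so `H` vanishes on `V_x` and the homotopy equation becomes `H ∂
v = v`. -/
theorem IsHomotopyAt.diff_injective (h : V.IsHomotopyAt x H) (hx : x ≠ ⊥) {v : M}
    (hv : v ∈ V.comp x) (h0 : V.diff v = 0) : v = 0 := by
  have h1 := h.mem x le_rfl hx v hv
  have h2 : H v = 0 := by
    rw [← Submodule.mem_bot K]
    exact SetLike.le_def.1 (iSup₂_le fun z hz => absurd hz.1.lt hz.2.not_gt) h1
  rw [← h.homotopy x le_rfl hx v hv, h0, h2, map_zero, map_zero, add_zero]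

/-- The preimage is `H w`: as `x` is not an atom, the elements `y ⋖ x` are different from `⊥`, so
the homotopy equation holds on `V_y`, and `x` is the only element of `L_{≤ x}` that covers `y`. -/
theorem IsHomotopyAt.exists_of_diff_eq_zero (h : V.IsHomotopyAt x H)
    (ha : ¬ IsAtom x) {w : M} (hw : w ∈ ⨆ y, ⨆ _ : y ⋖ x, V.comp y) (h0 : V.diff w = 0) :
    ∃ v ∈ V.comp x, V.diff v = w := by
  have key : H w ∈ V.comp x ∧ H (V.diff w) + V.diff (H w) = w := by
    refine V.iSup₂_induction
      (p := fun w => H w ∈ V.comp x ∧ H (V.diff w) + V.diff (H w) = w) hw ?_ (by simp) ?_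
    · intro y hy v hv
      have hy0 : y ≠ ⊥ := by
        rintro rfl
        exact ha (bot_covBy_iff.1 hy)
      refine ⟨SetLike.le_def.1 (iSup₂_le fun z hz => ?_) (h.mem y hy.le hy0 v hv),
        h.homotopy y hy.le hy0 v hv⟩
      rw [(hy.eq_or_eq hz.1.le hz.2).resolve_left hz.1.ne']
    · rintro a b ⟨ha, ha'⟩ ⟨hb, hb'⟩
      simp only [map_add]
      exact ⟨add_mem ha hb, by rw [add_add_add_comm, ha', hb']⟩
  refine ⟨H w, key.1, ?_⟩
  have := key.2
  rwa [h0, map_zero, zero_add] at this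

theorem IsHomotopyAt.acyclic (h : V.IsHomotopyAt x H) (hx : ∀ y, y ≤ x) : V.Acyclic := by
  intro i hi v hv h0
  have key : H v ∈ V.deg (i + 1) ∧ H (V.diff v) + V.diff (H v) = v := by
    refine V.iSup₂_induction
      (p := fun v => H v ∈ V.deg (i + 1) ∧ H (V.diff v) + V.diff (H v) = v) hv ?_ (by simp) ?_
    · intro y hy v hv
      have hy0 : y ≠ ⊥ := by
        rintro rfl
        rw [rk_bot] at hy
        omega
      exact ⟨V.iSup₂_mono' (fun z hz => by rw [rk_covBy hz.1, hy]) (h.mem y (hx y) hy0 v hv),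
        h.homotopy y (hx y) hy0 v hv⟩
    · rintro a b ⟨ha, ha'⟩ ⟨hb, hb'⟩
      simp only [map_add]
      exact ⟨add_mem ha hb, by rw [add_add_add_comm, ha', hb']⟩
  refine ⟨H v, key.1, ?_⟩
  have := key.2
  rwa [h0, map_zero, zero_add] at this

theorem Acyclic.osComplexSym (h : (osComplex V).Acyclic) : (osComplexSym V).Acyclic := by
  intro i hi v hv h0
  obtain ⟨w, hw, e⟩ := h i hi v (mem_osComplexSym_iSup.1 hv) h0
  exact ⟨w, mem_osComplexSym_iSup.2 hw, e⟩

end LGradedComplex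

end GenOS

end

/-! ### The proposition -/

theorem mainTheorem5 {K L M : Type*} [Field K] [CharZero K] [Lattice L] [OrderBot L] [Fintype L]
    [IsAtomistic L] [IsUpperModularLattice L] [AddCommGroup M] [Module K M]
    (V : GenOS.LGradedComplex K L M) (hV : V.LContractible) :
    ∃ A : GenOS.LGradedComplex K L (GenOS.OSAlgebra V),
      A.comp = GenOS.osComp V ∧ A.diff = GenOS.osDiff V ∧ (∀ i, A.deg i = GenOS.osDeg V i) ∧
      A.LContractible ∧
      ((∀ a, IsAtom a → ∀ v ∈ V.comp a, V.diff v = 0 → v = 0) →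
        (∃ φ : ↥(⨆ x, GenOS.minimalComp (GenOS.idealDatum V) x)
            ≃ₗ[SymmetricAlgebra K (V.comp ⊥)] GenOS.OSAlgebra V,
          (∀ s, φ (GenOS.minimalBase (GenOS.idealDatum V) s) =
            algebraMap (SymmetricAlgebra K (V.comp ⊥)) (GenOS.OSAlgebra V) s) ∧
          (∀ v, φ ((GenOS.minimalComplex (GenOS.idealDatum V)).diff v) = A.diff (φ v)) ∧
          (∀ x v, v ∈ (GenOS.minimalComplex (GenOS.idealDatum V)).comp x ↔ φ v ∈ A.comp x)) ∧
        (GenOS.minimalComplex (GenOS.idealDatum V)).Acyclic) := by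
  have hH := GenOS.exists_osIsHomotopyAt hV
  have hacyc : (GenOS.osComplexSym V).Acyclic := by
    -- The join of all elements is the top of `L`, so this homotopy contracts the whole complex.
    obtain ⟨H, h⟩ := hH (Finset.univ.sup id)
    exact (h.acyclic fun y => Finset.le_sup (f := id) (Finset.mem_univ y)).osComplexSym
  refine ⟨GenOS.osComplex V, rfl, rfl, GenOS.osComplex_deg,
    fun x => (hH x).elim fun _ h => h.nonempty, fun _ => ?_⟩
  -- The homotopy at each single `x` supplies injectivity of `∂` at `x` and exactness just below
  -- `x`. It is only `K`-linear, which is enough since both are statements about elements.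
  obtain ⟨φ, h0, hd, hc⟩ := (GenOS.osComplexSym V).exists_minimalComplex_equiv
    (GenOS.idealDatum V) (Algebra.linearMap _ _) GenOS.algebraMap_osAlgebra_injective
    GenOS.range_algebraMap_osAlgebra
    (fun x hx v hv h => (hH x).elim fun _ hh => hh.diff_injective hx hv h)
    (fun x _ ha w hw h => (hH x).elim fun _ hh =>
      hh.exists_of_diff_eq_zero ha (GenOS.mem_osComplexSym_iSup.1 hw) h)
    GenOS.osComplexSym_map_atom
  exact ⟨⟨φ, h0, hd, hc⟩, hacyc.of_equiv φ hd hc⟩
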